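/- Let $n_1,\dots,n_r$ be natural numbers, $n=n_1+\dots+n_r$, and let $G=\mathfrak S_{n_1}\times\dots\times\mathfrak S_{n_r}$, embedded in $\mathfrak S_n$ by letting $\mathfrak S_{n_i}$ permute the $i$-th block $\{n_1+\dots+n_{i-1}+1,\dots,n_1+\dots+n_i\}$ of $\{1,\dots,n\}$, act on $\mathbb C[x_1,\dots,x_n]$ by $(\sigma f)(x_1,\dots,x_n)=f(x_{\sigma(1)},\dots,x_{\sigma(n)})$. Let $\mathbb C[x_1,\dots,x_n]^{G}=\mathbb C[y_1,\dots,y_n]$ with $y_1,\dots,y_n$ algebraically independent, let $\Delta$ be the product over all blocks of the differences $x_a-x_b$, $a<b$ in the block, and let $\mathcal O_U=\mathbb C[x_1,\dots,x_n,\Delta^{-1}]$, with the induced action of $G$. Let $\mathcal D_V=\mathbb C\langle y_1,\dots,y_n,\partial/\partial y_1,\dots,\partial/\partial y_n,\Delta^{-2}\rangle$, acting on $\mathcal O_U$, where $\partial/\partial y_j$ is the derivation of $\mathcal O_U$ with $\partial y_k/\partial y_j=\delta_{jk}$. Let $\lambda=(\lambda^1,\dots,\lambda^r)$ be an $r$-tuple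 of Young diagrams with $|\lambda^i|=n_i$. A standard $r$-tableau $T=(T^1,\dots,T^r)$ of shape $\lambda$ is a filling of the boxes of $\lambda$ with $1,\dots,n$, each used once, increasing along the rows and down the columns of every $T^i$; it is natural if $T^i$ contains exactly the numbers of the $i$-th block. Write $ST(\lambda)$ and $NST(\lambda)$ for the sets of standard and of natural standard $r$-tableaux. For $S\in ST(\lambda)$ let $w(S)$ be the word obtained by reading $S^1,\dots,S^r$ in turn, each by columns from left to right and each column from bottom to top; the index of $1$ is $0$, and if $k$ has index $p$, then $k+1$ has index $p+1$ or $p$ according as it stands to the left or to the right of $k$ in $w(S)$. For $T\in NST(\lambda)$ let $x_T^{i(S)}$ be the product over the boxes $b$ of $\lambda$ of $x_{T(b)}^{m(b)}$, where $m(b)$ is the index of $S(b)$. Let $e_T=e_{T^1}\cdots e_{T^r}$ with $$e_{T^i}=\frac{f^{\lambda^i}}{n_i!}\sum_{\sigma\in R(T^i),\,\tau\in C(T^i)}\operatorname{sgn}(\tau)\,\tau\sigma,$$ where $R(T^i)$ and $C(T^i)$ are the row and column stabilizers of $T^i$ and $f^{\lambda^i}$ is the number of standard tableaux of shape $\lambda^i$.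 Put $F_T^S=e_T(x_T^{i(S)})$ and $V^S(\lambda)=\operatorname{span}_{\mathbb C}\{F_T^S : T\in NST(\lambda)\}$. **Theorem.** Let $S\in ST(\lambda)$, $T\in NST(\lambda)$ and $D\in\mathcal D_V$ with $D(F_T^S)\neq0$. Then $V^S(\lambda)$ is an irreducible $\mathbb C[G]$-submodule of $\mathcal O_U$, its image $D(V^S(\lambda))$ is a $\mathbb C[G]$-submodule of $\mathcal O_U$ isomorphic to $V^S(\lambda)$, and $D(V^S(\lambda))$ is generated by $D(F_T^S)$ as a $\mathbb C[G]$-module. -/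

import Mathlib

open MvPolynomial

noncomputable section

namespace HigherSpecht

/-! ### Polynomials and the action of the symmetric group

The numbers `1, …, n` (with `n = n₁ + ⋯ + n_r`) are represented by the elements `0, …, n - 1` of
`Fin (∑ i, ν i)`.  The order isomorphism `finSigmaFinEquiv` cuts this set into `r` consecutive
blocks, the `i`-th one having `ν i` elements. -/

/-- The polynomial ring `ℂ[x₁, …, x_n]`, where `n = n₁ + ⋯ + n_r`. -/
abbrev OX {r : ℕ} (ν : Fin r → ℕ) : Type := MvPolynomial (Fin (∑ i, ν i)) ℂ

/-- The group `𝔖_{n₁} × ⋯ × 𝔖_{n_r}`. -/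
abbrev SymProd {r : ℕ} (ν : Fin r → ℕ) : Type := (i : Fin r) → Equiv.Perm (Fin (ν i))

/-- The block (an element of `{1, …, r}`) that contains a given number. -/
def block {r : ℕ} (ν : Fin r → ℕ) (k : Fin (∑ i, ν i)) : Fin r := (finSigmaFinEquiv.symm k).1

/-- The natural embedding of `𝔖_{n₁} × ⋯ × 𝔖_{n_r}` into `𝔖_n`. -/
def embed {r : ℕ} (ν : Fin r → ℕ) : SymProd ν →* Equiv.Perm (Fin (∑ i, ν i)) :=
  (finSigmaFinEquiv.permCongrHom.toMonoidHom).comp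
    (Equiv.Perm.sigmaCongrRightHom fun i => Fin (ν i))

theorem embed_apply {r : ℕ} (ν : Fin r → ℕ) (g : SymProd ν) (i : Fin r) (a : Fin (ν i)) :
    embed ν g (finSigmaFinEquiv ⟨i, a⟩) = finSigmaFinEquiv ⟨i, g i a⟩ := by
  simp [embed, Equiv.permCongrHom, Equiv.permCongr_apply]

/-- The action of `𝔖_n` on polynomials, `(σ f)(x₁, …, x_n) = f(x_{σ(1)}, …, x_{σ(n)})`. -/
def permRep {r : ℕ} (ν : Fin r → ℕ) :
    Representation ℂ (Equiv.Perm (Fin (∑ i, ν i))) (OX ν) where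
  toFun σ := (rename σ).toLinearMap
  map_one' := by
    refine LinearMap.ext fun f => ?_
    simp
  map_mul' σ τ := by
    refine LinearMap.ext fun f => ?_
    simp [rename_rename, Equiv.Perm.coe_mul]

/-- `𝒪_Y`, the algebra of polynomials invariant under `𝔖_{n₁} × ⋯ × 𝔖_{n_r}`. -/
def OY {r : ℕ} (ν : Fin r → ℕ) : Subalgebra ℂ (OX ν) where
  carrier := {f | ∀ g : SymProd ν, rename (embed ν g) f = f}
  mul_mem' hf hg σ := by rw [map_mul, hf σ, hg σ]
  add_mem' hf hg σ := by rw [map_add, hf σ, hg σ]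
  algebraMap_mem' c σ := by simp

/-! ### The localization `𝒪_U` -/

/-- `Δ`, the product over the blocks of the differences `x_a - x_b`, `a < b` in the block. -/
def disc {r : ℕ} (ν : Fin r → ℕ) : OX ν :=
  ∏ i : Fin r, ∏ a : Fin (ν i), ∏ b ∈ Finset.Ioi a,
    (X (finSigmaFinEquiv ⟨i, a⟩) - X (finSigmaFinEquiv ⟨i, b⟩))

/-- `𝒪_U = ℂ[x₁, …, x_n, Δ⁻¹]`. -/
abbrev OU {r : ℕ} (ν : Fin r → ℕ) : Type := Localization.Away (disc ν)

theorem isUnit_sub {r : ℕ} (ν : Fin r → ℕ) (i : Fin r) (a b : Fin (ν i)) (hab : a ≠ b) :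
    IsUnit (algebraMap (OX ν) (OU ν)
      (X (finSigmaFinEquiv ⟨i, a⟩) - X (finSigmaFinEquiv ⟨i, b⟩))) := by
  have key : ∀ a b : Fin (ν i), a < b → IsUnit (algebraMap (OX ν) (OU ν)
      (X (finSigmaFinEquiv ⟨i, a⟩) - X (finSigmaFinEquiv ⟨i, b⟩))) := by
    intro a b h
    refine isUnit_of_dvd_unit (map_dvd _ ?_)
      (IsLocalization.Away.algebraMap_isUnit (S := OU ν) (disc ν))
    refine dvd_trans ?_ (Finset.dvd_prod_of_mem _ (Finset.mem_univ i))
    refine dvd_trans ?_ (Finset.dvd_prod_of_mem _ (Finset.mem_univ a))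
    exact Finset.dvd_prod_of_mem
      (fun b => (X (finSigmaFinEquiv ⟨i, a⟩) - X (finSigmaFinEquiv ⟨i, b⟩) : OX ν))
      (Finset.mem_Ioi.2 h)
  rcases lt_or_gt_of_ne hab with h | h
  · exact key a b h
  · rw [← neg_sub, map_neg]
    exact (key b a h).neg

theorem isUnit_rename_disc {r : ℕ} (ν : Fin r → ℕ) (g : SymProd ν) :
    IsUnit (algebraMap (OX ν) (OU ν) (rename (embed ν g) (disc ν))) := by
  simp only [disc, map_prod]
  refine IsUnit.prod_iff.2 fun i _ => IsUnit.prod_iff.2 fun a _ => IsUnit.prod_iff.2 fun b hb => ?_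
  rw [map_sub, rename_X, rename_X, embed_apply, embed_apply]
  exact isUnit_sub ν i _ _ fun h => (Finset.mem_Ioi.1 hb).ne ((g i).injective h)

/-- The automorphism of `𝒪_U` induced by an element of `𝔖_{n₁} × ⋯ × 𝔖_{n_r}`. -/
def actU {r : ℕ} (ν : Fin r → ℕ) (g : SymProd ν) : OU ν →ₐ[ℂ] OU ν :=
  IsLocalization.liftAlgHom (M := Submonoid.powers (disc ν))
    (f := (IsScalarTower.toAlgHom ℂ (OX ν) (OU ν)).comp (rename (embed ν g))) (by
      rintro ⟨_, k, rfl⟩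
      simpa using (isUnit_rename_disc ν g).pow k)

theorem actU_algebraMap {r : ℕ} (ν : Fin r → ℕ) (g : SymProd ν) (f : OX ν) :
    actU ν g (algebraMap (OX ν) (OU ν) f) = algebraMap (OX ν) (OU ν) (rename (embed ν g) f) := by
  simp [actU]

theorem algHom_ext_OU {r : ℕ} (ν : Fin r → ℕ) {φ ψ : OU ν →ₐ[ℂ] OU ν}
    (h : ∀ f : OX ν, φ (algebraMap (OX ν) (OU ν) f) = ψ (algebraMap (OX ν) (OU ν) f)) :
    φ = ψ := by
  apply AlgHom.coe_ringHom_injective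
  exact IsLocalization.ringHom_ext (Submonoid.powers (disc ν)) (RingHom.ext h)

/-- `𝒪_U` as a representation of `𝔖_{n₁} × ⋯ × 𝔖_{n_r}`, i.e. as a module over its group
algebra. -/
def repU {r : ℕ} (ν : Fin r → ℕ) : Representation ℂ (SymProd ν) (OU ν) where
  toFun g := (actU ν g).toLinearMap
  map_one' := by
    have h : actU ν 1 = AlgHom.id ℂ (OU ν) :=
      algHom_ext_OU ν fun f => by simp [actU_algebraMap]
    rw [h]
    rfl
  map_mul' g g' := by
    have h : actU ν (g * g') = (actU ν g).comp (actU ν g') :=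
      algHom_ext_OU ν fun f => by simp [actU_algebraMap, rename_rename, Equiv.Perm.coe_mul]
    rw [h]
    rfl

/-! ### The algebra `𝒟_V` of differential operators -/

/-- A derivation `d` of `𝒪_U` is `∂/∂y_j` if `d y_k = δ_{jk}` for all `k`.  (When the `y_k` are
algebraically independent generators of `𝒪_Y` there is exactly one such derivation, because `𝒪_U`
is étale over `𝒪_V`.) -/
def IsPartialY {r : ℕ} (ν : Fin r → ℕ) (y : Fin (∑ i, ν i) → OX ν) (j : Fin (∑ i, ν i))
    (d : Derivation ℂ (OU ν) (OU ν)) : Prop :=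
  ∀ k, d (algebraMap (OX ν) (OU ν) (y k)) = if k = j then 1 else 0

/-- `𝒟_V = ℂ⟨y₁, …, y_n, ∂/∂y₁, …, ∂/∂y_n, Δ⁻²⟩`, as an algebra of operators on `𝒪_U`. -/
def DV {r : ℕ} (ν : Fin r → ℕ) (y : Fin (∑ i, ν i) → OX ν) :
    Subalgebra ℂ (Module.End ℂ (OU ν)) :=
  Algebra.adjoin ℂ
    (Set.range (fun j => LinearMap.mulLeft ℂ (algebraMap (OX ν) (OU ν) (y j))) ∪
      {P | ∃ j, ∃ d : Derivation ℂ (OU ν) (OU ν), IsPartialY ν y j d ∧ P = d.toLinearMap} ∪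
      {LinearMap.mulLeft ℂ (IsLocalization.Away.invSelf (S := OU ν) (disc ν) ^ 2)})

/-! ### Diagrams and tableaux -/

/-- An `r`-diagram of type `(n₁, …, n_r)`: an `r`-tuple of Young diagrams of sizes
`n₁, …, n_r`. -/
structure RDiagram {r : ℕ} (ν : Fin r → ℕ) where
  shape : Fin r → YoungDiagram
  card_shape : ∀ i, (shape i).card = ν i

/-- A filling of a Young diagram increases strictly along every row and down every column.  A cell
is a pair (row, column). -/
def StrictFilling {μ : YoungDiagram} {α : Type} [LT α] (t : μ.cells → α) : Prop :=
  (∀ c c' : μ.cells, c.1.1 = c'.1.1 → c.1.2 < c'.1.2 → t c < t c') ∧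
    (∀ c c' : μ.cells, c.1.2 = c'.1.2 → c.1.1 < c'.1.1 → t c < t c')

/-- `f^μ`, the number of standard tableaux of shape `μ`. -/
def numStd (μ : YoungDiagram) : ℕ :=
  Nat.card {t : μ.cells ≃ Fin μ.card // StrictFilling t}

variable {r : ℕ} {ν : Fin r → ℕ}

/-- The boxes of an `r`-diagram. -/
abbrev RDiagram.Box (lam : RDiagram ν) : Type := Σ i : Fin r, (lam.shape i).cells

/-- `ST(λ)`: the standard `r`-tableaux of shape `λ`. -/
structure ST (lam : RDiagram ν) where
  entry : lam.Box ≃ Fin (∑ i, ν i)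
  strict : ∀ i, StrictFilling fun c => entry ⟨i, c⟩

/-- `T` is natural: the component `T^i` is filled with the numbers of the `i`-th block. -/
def ST.IsNatural {lam : RDiagram ν} (T : ST lam) : Prop :=
  ∀ b : lam.Box, block ν (T.entry b) = b.1

/-- The order in which the boxes are read to form the word of a tableau: the components
successively, in each of them the columns from left to right, each column from bottom to top. -/
def ReadBefore {lam : RDiagram ν} (b b' : lam.Box) : Prop :=
  b.1 < b'.1 ∨ b.1 = b'.1 ∧
    (b.2.1.2 < b'.2.1.2 ∨ b.2.1.2 = b'.2.1.2 ∧ b'.2.1.1 < b.2.1.1)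

open Classical in
/-- The index of the number `k` (counted from `0`) in the word `w(S)`: the first number has index
`0`; if `k` has index `p`, then the index of `k + 1` is `p + 1` if `k + 1` lies to the left of `k`
in the word, and `p` otherwise. -/
def ST.wordIndex {lam : RDiagram ν} (S : ST lam) : ℕ → ℕ
  | 0 => 0
  | k + 1 => S.wordIndex k +
      if ∃ h : k + 1 < ∑ i, ν i,
        ReadBefore (S.entry.symm ⟨k + 1, h⟩) (S.entry.symm ⟨k, by omega⟩) then 1 else 0

/-- The index tableau `i(S)`. -/
def ST.index {lam : RDiagram ν} (S : ST lam) (b : lam.Box) : ℕ := S.wordIndex (S.entry b)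

/-- The monomial `x_T^{i(S)}`. -/
def mono {lam : RDiagram ν} (T S : ST lam) : OX ν :=
  ∏ b : lam.Box, X (T.entry b) ^ S.index b

/-! ### Young symmetrizers and higher Specht polynomials -/

/-- `R(T^i)`: the permutations of the entries of `T^i` that preserve every row of `T^i`. -/
def ST.rowStab {lam : RDiagram ν} (T : ST lam) (i : Fin r) :
    Set (Equiv.Perm (Fin (∑ i, ν i))) :=
  {σ | (∀ b : lam.Box, b.1 ≠ i → σ (T.entry b) = T.entry b) ∧
    ∀ c : (lam.shape i).cells, ∃ c' : (lam.shape i).cells,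
      σ (T.entry ⟨i, c⟩) = T.entry ⟨i, c'⟩ ∧ c'.1.1 = c.1.1}

/-- `C(T^i)`: the permutations of the entries of `T^i` that preserve every column of `T^i`. -/
def ST.colStab {lam : RDiagram ν} (T : ST lam) (i : Fin r) :
    Set (Equiv.Perm (Fin (∑ i, ν i))) :=
  {τ | (∀ b : lam.Box, b.1 ≠ i → τ (T.entry b) = T.entry b) ∧
    ∀ c : (lam.shape i).cells, ∃ c' : (lam.shape i).cells,
      τ (T.entry ⟨i, c⟩) = T.entry ⟨i, c'⟩ ∧ c'.1.2 = c.1.2}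

open Classical in
/-- The Young symmetrizer
`e_{T^i} = (f^{λ^i} / n_i!) ∑_{σ ∈ R(T^i), τ ∈ C(T^i)} sgn(τ) τ σ`. -/
def ST.youngSymm {lam : RDiagram ν} (T : ST lam) (i : Fin r) :
    MonoidAlgebra ℂ (Equiv.Perm (Fin (∑ i, ν i))) :=
  ((numStd (lam.shape i) : ℂ) / ((ν i).factorial : ℂ)) •
    ∑ σ ∈ Finset.univ.filter (· ∈ T.rowStab i), ∑ τ ∈ Finset.univ.filter (· ∈ T.colStab i),
      MonoidAlgebra.single (τ * σ) (((Equiv.Perm.sign τ : ℤ)) : ℂ)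

/-- `e_T = e_{T^1} ⋯ e_{T^r}`. -/
def ST.symmetrizer {lam : RDiagram ν} (T : ST lam) :
    MonoidAlgebra ℂ (Equiv.Perm (Fin (∑ i, ν i))) :=
  (List.ofFn fun i => T.youngSymm i).prod

/-- The higher Specht polynomial `F_T^S = e_T (x_T^{i(S)})`. -/
def higherSpecht {lam : RDiagram ν} (T S : ST lam) : OX ν :=
  (permRep ν).asAlgebraHom T.symmetrizer (mono T S)

/-- The higher Specht polynomial `F_T^S`, as an element of `𝒪_U`. -/
def higherSpechtU {lam : RDiagram ν} (T S : ST lam) : OU ν :=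
  algebraMap (OX ν) (OU ν) (higherSpecht T S)

/-- `V^S(λ)`: the linear span of the `F_T^S`, where `T` runs through the natural standard
tableaux. -/
def spechtSpan {lam : RDiagram ν} (S : ST lam) : Submodule ℂ (OU ν) :=
  Submodule.span ℂ {F | ∃ T : ST lam, T.IsNatural ∧ F = higherSpechtU T S}

end HigherSpecht

end

/-!
Write `G` for the product of symmetric groups.  Fix a natural tableau `T`; it identifies `G` with
the group `CellPerm` of tuples of permutations of the boxes of the diagrams, and `F_T^S` becomes a
multiple of `E = C⁻ R⁺ m`, where `m` is the monomial `x_T^{i(S)}`, `R⁺` is the sum over the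
row group and `C⁻` the signed sum over the column group (`HasLocalEntries.higherSpechtU_eq`: the
product of the Young symmetrizers of the components is multiplied out).  The other natural tableaux
have the form `T ∘ p`, and their higher Specht polynomials are `p F_T^S`
(`HasLocalEntries.higherSpechtU_comp`).  Hence everything about `V^S(λ)` is the theory of Specht
modules, carried out for the orbit of `E` in an arbitrary representation.

* The translates `p E` for which `T ∘ p` is standard span all translates (`mem_span_standard`).
  This is straightening: among the `p E` outside the span take one for which the pair
  `(∑ column · entry, ∑ row · entry)` is lexicographically maximal.  A descent in a column would be
  repaired by a column transposition, which multiplies the vector by `-1`; at a descent in a row,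
  `garnir_relation` writes the vector through fillings with a larger first weight.  So
  `V^S(λ)` is the `ℂ[G]`-module generated by `F_T^S`.
* `C⁻ g R⁺` is a multiple of `C⁻ R⁺` for every `g` (`exists_colAlt_apply_rowSum`, which rests on
  the combinatorial `exists_column_mul_row`).  So `C⁻` maps the module generated by `E` into the
  line of `E`, while it multiplies `E` by the order of the column group.  If the module is split
  into two complementary submodules (Maschke), `C⁻` is nonzero on one of them, which then contains
  `E` and is everything (`isIrreducible_of_rank_one`).  Here `E ≠ 0` because `D F_T^S ≠ 0`.
* Every operator in `𝒟_V` commutes with `G` (`DV_apply_repU`).  For `∂/∂y_j` this holds because a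
  derivation of `𝒪_U` is determined by its values on the invariants (`derivation_eq_zero`): `x_a`
  is a root of the polynomial `∏ (t - x_b)` over its block, whose coefficients are invariant and
  whose derivative at `x_a` is a unit of `𝒪_U`.

So `D` is an equivariant map on the irreducible module `V^S(λ)` that does not vanish on its
generator, and Schur's lemma gives the rest (`exists_subrepresentation_map`).
-/

noncomputable section

open MvPolynomial

namespace HigherSpecht

/-! ### Factoring permutations of a Young diagram -/

/-- If a permutation of the cells of a Young diagram never sends two cells of one row to one column,
it is the product of a column-preserving and a row-preserving permutation.  The row-preserving
factor sends `c` to the cell of the column of `g c` whose row is the number of cells above `c` that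
`g` sends to that column.  This number is at most the row of `c`, and summing over all cells shows
that equality holds everywhere. -/
theorem exists_column_mul_row {μ : YoungDiagram} (g : Equiv.Perm μ.cells)
    (hg : ∀ c c' : μ.cells, c.1.1 = c'.1.1 → (g c).1.2 = (g c').1.2 → c = c') :
    ∃ τ σ : Equiv.Perm μ.cells, (∀ c, (τ c).1.2 = c.1.2) ∧ (∀ c, (σ c).1.1 = c.1.1) ∧
      g = τ * σ := by
  classical
  let below : μ.cells → Finset μ.cells := fun c =>
    Finset.univ.filter fun c' => (g c').1.2 = (g c).1.2 ∧ c'.1.1 < c.1.1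
  have below_le : ∀ c, (below c).card ≤ c.1.1 := by
    intro c
    rw [← Finset.card_range c.1.1]
    refine Finset.card_le_card_of_injOn (fun c' => c'.1.1) ?_ ?_
    · intro c' hc'
      simp only [below, Finset.coe_filter, Finset.mem_univ, true_and, Set.mem_ofPred_eq] at hc'
      simpa using hc'.2
    · intro c₁ h₁ c₂ h₂ h
      simp only [below, Finset.coe_filter, Finset.mem_univ, true_and, Set.mem_ofPred_eq] at h₁ h₂
      exact hg c₁ c₂ h (h₁.1.trans h₂.1.symm)
  have card_fiber : ∀ k, (Finset.univ.filter fun c' : μ.cells => (g c').1.2 = k).card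
      = μ.colLen k := by
    intro k
    rw [YoungDiagram.colLen_eq_card]
    refine Finset.card_nbij (fun c' => (g c').1) ?_ ?_ ?_
    · intro c' hc'
      have hk : (g c').1.2 = k := by simpa using hc'
      simp [YoungDiagram.mem_col_iff, hk]
    · intro c₁ _ c₂ _ h
      exact g.injective (Subtype.ext h)
    · intro x hx
      have hx' := YoungDiagram.mem_col_iff.1 hx
      exact ⟨g.symm ⟨x, hx'.1⟩, by simp [hx'.2], by simp⟩
  have below_lt : ∀ c, (below c).card < μ.colLen (g c).1.2 := by
    intro c
    rw [← card_fiber]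
    refine Finset.card_lt_card ((Finset.ssubset_iff_of_subset ?_).2 ⟨c, by simp, by simp [below]⟩)
    intro c' hc'
    simp only [below, Finset.mem_filter, Finset.mem_univ, true_and] at hc' ⊢
    exact hc'.1
  let q : μ.cells → μ.cells := fun c =>
    ⟨((below c).card, (g c).1.2), YoungDiagram.mem_iff_lt_colLen.2 (below_lt c)⟩
  have below_strict : ∀ c c', (g c).1.2 = (g c').1.2 → c.1.1 < c'.1.1 →
      (below c).card < (below c').card := by
    intro c c' h hlt
    refine Finset.card_lt_card ((Finset.ssubset_iff_of_subset ?_).2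
      ⟨c, by simp [below, h, hlt], by simp [below]⟩)
    intro d hd
    simp only [below, Finset.mem_filter, Finset.mem_univ, true_and] at hd ⊢
    exact ⟨hd.1.trans h, hd.2.trans hlt⟩
  have q_inj : Function.Injective q := by
    intro c c' h
    have h' := congrArg Subtype.val h
    simp only [q, Prod.mk.injEq] at h'
    refine hg c c' ?_ h'.2
    rcases lt_trichotomy c.1.1 c'.1.1 with hlt | heq | hlt
    · exact absurd h'.1 (below_strict c c' h'.2 hlt).ne
    · exact heq
    · exact absurd h'.1 (below_strict c' c h'.2.symm hlt).ne'
  let σ : Equiv.Perm μ.cells := Equiv.ofBijective q (Finite.injective_iff_bijective.1 q_inj)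
  have hsum : ∑ c, (below c).card = ∑ c : μ.cells, c.1.1 := by
    rw [← Equiv.sum_comp σ fun c => c.1.1]
    rfl
  have heq := (Finset.sum_eq_sum_iff_of_le fun c _ => below_le c).1 hsum
  refine ⟨g * σ⁻¹, σ, fun c => ?_, fun c => heq c (Finset.mem_univ c), by simp⟩
  obtain ⟨c, rfl⟩ := σ.surjective c
  rw [Equiv.Perm.mul_apply, Equiv.Perm.inv_def, Equiv.symm_apply_apply]
  rfl

/-! ### Row and column groups -/

section Groups

variable {ι : Type} (shape : ι → YoungDiagram)

/-- Tuples of permutations of the cells of the diagrams of a family. -/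
abbrev CellPerm : Type := (i : ι) → Equiv.Perm (shape i).cells

/-- The subgroup of tuples that preserve every row of every diagram. -/
def rowGroup : Subgroup (CellPerm shape) where
  carrier := {p | ∀ i c, (p i c).1.1 = c.1.1}
  mul_mem' ha hb i c := by simp [ha i, hb i]
  one_mem' i c := rfl
  inv_mem' {p} h i c := by simpa using (h i ((p i)⁻¹ c)).symm

/-- The subgroup of tuples that preserve every column of every diagram. -/
def colGroup : Subgroup (CellPerm shape) where
  carrier := {p | ∀ i c, (p i c).1.2 = c.1.2}
  mul_mem' ha hb i c := by simp [ha i, hb i]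
  one_mem' i c := rfl
  inv_mem' {p} h i c := by simpa using (h i ((p i)⁻¹ c)).symm

theorem mem_rowGroup {p : CellPerm shape} : p ∈ rowGroup shape ↔ ∀ i c, (p i c).1.1 = c.1.1 :=
  Iff.rfl

theorem mem_colGroup {p : CellPerm shape} : p ∈ colGroup shape ↔ ∀ i c, (p i c).1.2 = c.1.2 :=
  Iff.rfl

/-- The sign of a tuple, as a permutation of the disjoint union of the cells. -/
def cellSign [Fintype ι] : CellPerm shape →* ℤˣ where
  toFun p := ∏ i, Equiv.Perm.sign (p i)
  map_one' := by simp
  map_mul' p q := by simp [Finset.prod_mul_distrib]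

theorem cellSign_apply [Fintype ι] (p : CellPerm shape) :
    cellSign shape p = ∏ i, Equiv.Perm.sign (p i) := rfl

variable [DecidableEq ι]

theorem cellSign_mulSingle [Fintype ι] (i : ι) (π : Equiv.Perm (shape i).cells) :
    cellSign shape (Pi.mulSingle i π) = Equiv.Perm.sign π := by
  rw [cellSign_apply, Finset.prod_eq_single i]
  · simp
  · intro j _ hj
    simp [Pi.mulSingle_eq_of_ne hj]
  · simp

theorem mulSingle_mem_colGroup {i : ι} {π : Equiv.Perm (shape i).cells}
    (h : ∀ c, (π c).1.2 = c.1.2) : Pi.mulSingle i π ∈ colGroup shape := by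
  intro j c
  rcases eq_or_ne j i with rfl | hj
  · simpa using h c
  · simp [Pi.mulSingle_eq_of_ne hj]

theorem mulSingle_mem_rowGroup {i : ι} {π : Equiv.Perm (shape i).cells}
    (h : ∀ c, (π c).1.1 = c.1.1) : Pi.mulSingle i π ∈ rowGroup shape := by
  intro j c
  rcases eq_or_ne j i with rfl | hj
  · simpa using h c
  · simp [Pi.mulSingle_eq_of_ne hj]

theorem swap_row_preserving {μ : YoungDiagram} {x y : μ.cells} (h : x.1.1 = y.1.1) (c : μ.cells) :
    (Equiv.swap x y c).1.1 = c.1.1 := by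
  rw [Equiv.swap_apply_def]
  split_ifs with h₁ h₂
  · rw [h₁, h]
  · rw [h₂, h]
  · rfl

theorem swap_col_preserving {μ : YoungDiagram} {x y : μ.cells} (h : x.1.2 = y.1.2) (c : μ.cells) :
    (Equiv.swap x y c).1.2 = c.1.2 := by
  rw [Equiv.swap_apply_def]
  split_ifs with h₁ h₂
  · rw [h₁, h]
  · rw [h₂, h]
  · rfl

theorem mul_mulSingle_swap (p : CellPerm shape) (i : ι) (x y : (shape i).cells) :
    p * Pi.mulSingle i (Equiv.swap x y) = Pi.mulSingle i (Equiv.swap (p i x) (p i y)) * p := by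
  funext j
  rcases eq_or_ne j i with rfl | hj
  · simp [Equiv.mul_swap_eq_swap_mul]
  · simp [Pi.mulSingle_eq_of_ne hj]

end Groups

/-! ### Row symmetrizers and column antisymmetrizers -/

section Symmetrizer

variable {ι : Type} [Fintype ι] {shape : ι → YoungDiagram}
  {M : Type*} [AddCommGroup M] [Module ℂ M] (ρ : Representation ℂ (CellPerm shape) M)

instance : Fintype (rowGroup shape) :=
  haveI : Finite (CellPerm shape) := Pi.finite
  Fintype.ofFinite _

instance : Fintype (colGroup shape) :=
  haveI : Finite (CellPerm shape) := Pi.finite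
  Fintype.ofFinite _

/-- The row symmetrizer `∑ σ` over the row group, as an operator. -/
def rowSum : Module.End ℂ M := ∑ σ : rowGroup shape, ρ σ

/-- The column antisymmetrizer `∑ sgn(τ) τ` over the column group, as an operator. -/
def colAlt : Module.End ℂ M := ∑ τ : colGroup shape, ((cellSign shape τ : ℤ) : ℂ) • ρ τ

theorem rowSum_apply (v : M) : rowSum ρ v = ∑ σ : rowGroup shape, ρ σ v := by
  simp [rowSum]

theorem colAlt_apply (v : M) :
    colAlt ρ v = ∑ τ : colGroup shape, ((cellSign shape τ : ℤ) : ℂ) • ρ τ v := by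
  simp [colAlt]

theorem apply_rowSum {σ : CellPerm shape} (hσ : σ ∈ rowGroup shape) (v : M) :
    ρ σ (rowSum ρ v) = rowSum ρ v := by
  rw [rowSum_apply, map_sum]
  refine Fintype.sum_equiv (Equiv.mulLeft (⟨σ, hσ⟩ : rowGroup shape)) _ _ fun σ' => ?_
  simp

theorem sign_mul_sign_complex (u : ℤˣ) : ((u : ℤ) : ℂ) * ((u : ℤ) : ℂ) = 1 := by
  rcases Int.units_eq_one_or u with rfl | rfl <;> simp

theorem apply_colAlt {τ : CellPerm shape} (hτ : τ ∈ colGroup shape) (v : M) :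
    ρ τ (colAlt ρ v) = ((cellSign shape τ : ℤ) : ℂ) • colAlt ρ v := by
  rw [colAlt_apply, map_sum, Finset.smul_sum]
  refine Fintype.sum_equiv (Equiv.mulLeft (⟨τ, hτ⟩ : colGroup shape)) _ _ fun τ' => ?_
  simp [smul_smul, ← mul_assoc, sign_mul_sign_complex]

theorem colAlt_apply_mem {τ : CellPerm shape} (hτ : τ ∈ colGroup shape) (v : M) :
    colAlt ρ (ρ τ v) = ((cellSign shape τ : ℤ) : ℂ) • colAlt ρ v := by
  rw [colAlt_apply, colAlt_apply, Finset.smul_sum]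
  refine Fintype.sum_equiv (Equiv.mulRight (⟨τ, hτ⟩ : colGroup shape)) _ _ fun τ' => ?_
  have h := sign_mul_sign_complex (cellSign shape τ)
  simp only [Equiv.coe_mulRight, Subgroup.coe_mul, map_mul, Module.End.mul_apply, smul_smul,
    Units.val_mul, Int.cast_mul]
  rw [mul_left_comm, h, mul_one]

theorem colAlt_colAlt (v : M) :
    colAlt ρ (colAlt ρ v) = (Fintype.card (colGroup shape) : ℂ) • colAlt ρ v := by
  conv_lhs => rw [colAlt_apply]
  simp only [apply_colAlt ρ (Subtype.prop _), smul_smul, sign_mul_sign_complex, one_smul]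
  simp [← Nat.cast_smul_eq_nsmul ℂ]

/-- `C⁻ g R⁺` is a scalar multiple of `C⁻ R⁺`: either `g = τ σ` with `τ` in the column and `σ` in
the row group, or some row transposition is conjugated by `g` to a column transposition, which forces
`C⁻ g R⁺ = - C⁻ g R⁺`. -/
theorem exists_colAlt_apply_rowSum [DecidableEq ι] (g : CellPerm shape) (v : M) :
    ∃ a : ℂ, colAlt ρ (ρ g (rowSum ρ v)) = a • colAlt ρ (rowSum ρ v) := by
  by_cases h : ∀ i (c c' : (shape i).cells), c.1.1 = c'.1.1 → (g i c).1.2 = (g i c').1.2 → c = c'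
  · choose τ σ hτ hσ hg using fun i => exists_column_mul_row (g i) (h i)
    obtain rfl : g = τ * σ := funext hg
    refine ⟨((cellSign shape τ : ℤ) : ℂ), ?_⟩
    rw [map_mul, Module.End.mul_apply, apply_rowSum ρ ((mem_rowGroup shape).2 hσ),
      colAlt_apply_mem ρ ((mem_colGroup shape).2 hτ)]
  · push Not at h
    obtain ⟨i, c, c', hrow, hcol, hne⟩ := h
    refine ⟨0, ?_⟩
    have h₁ : ρ g (rowSum ρ v) =
        ρ (Pi.mulSingle i (Equiv.swap (g i c) (g i c'))) (ρ g (rowSum ρ v)) := by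
      rw [← Module.End.mul_apply (ρ _) (ρ g), ← map_mul, ← mul_mulSingle_swap, map_mul,
        Module.End.mul_apply,
        apply_rowSum ρ (mulSingle_mem_rowGroup shape (swap_row_preserving hrow))]
    have h₂ := congrArg (colAlt ρ) h₁
    rw [colAlt_apply_mem ρ (mulSingle_mem_colGroup shape (swap_col_preserving hcol)),
      cellSign_mulSingle, Equiv.Perm.sign_swap (fun h => hne ((g i).injective h))] at h₂
    rw [zero_smul]
    have := IsAddTorsionFree.of_isTorsionFree ℂ M
    refine self_eq_neg.1 (h₂.trans ?_)
    simp

theorem exists_colAlt_apply_colAlt_rowSum [DecidableEq ι] (g : CellPerm shape) (v : M) :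
    ∃ a : ℂ, colAlt ρ (ρ g (colAlt ρ (rowSum ρ v))) = a • colAlt ρ (rowSum ρ v) := by
  choose a ha using fun g => exists_colAlt_apply_rowSum ρ g v
  refine ⟨∑ τ : colGroup shape, ((cellSign shape τ : ℤ) : ℂ) * a (g * τ), ?_⟩
  rw [Finset.sum_smul]
  conv_lhs => enter [2, 2]; rw [colAlt_apply]
  simp only [map_sum, map_smul]
  refine Finset.sum_congr rfl fun τ _ => ?_
  rw [mul_smul, ← ha, map_mul, Module.End.mul_apply]

end Symmetrizer

/-! ### Irreducibility and equivariant images -/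

/-- A cyclic representation `ℂ[G] E` is irreducible as soon as some operator `P`, preserving all
invariant subspaces, maps it into the line of `E` and does not kill `E`. -/
theorem isIrreducible_of_rank_one {G M : Type*} [Group G] [Finite G] [AddCommGroup M] [Module ℂ M]
    (ρ : Representation ℂ G M) (V : Subrepresentation ρ) (P : Module.End ℂ M) (E : M) (c : ℂ)
    (hV : V.toSubmodule = Submodule.span ℂ (Set.range fun g => ρ g E))
    (hP : ∀ U : Submodule ℂ M, (∀ g, ∀ u ∈ U, ρ g u ∈ U) → ∀ u ∈ U, P u ∈ U)
    (hPE : ∀ g, P (ρ g E) ∈ Submodule.span ℂ {E}) (hc : P E = c • E) (hc0 : c ≠ 0) (hE : E ≠ 0) :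
    V.toRepresentation.IsIrreducible := by
  have hEV : E ∈ V.toSubmodule := by
    rw [hV]
    exact Submodule.subset_span ⟨1, by simp⟩
  have hPV : ∀ v ∈ V.toSubmodule, P v ∈ Submodule.span ℂ {E} := by
    intro v hv
    rw [hV] at hv
    refine (Submodule.span_le (p := (Submodule.span ℂ {E}).comap P)).2 ?_ hv
    rintro _ ⟨g, rfl⟩
    exact hPE g
  have htop : ∀ U : Subrepresentation V.toRepresentation, ⟨E, hEV⟩ ∈ U → U = ⊤ := by
    intro U hU
    refine top_unique fun v _ => ?_
    have hle : V.toSubmodule ≤ U.toSubmodule.map V.toSubmodule.subtype := by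
      refine hV.le.trans (Submodule.span_le.2 ?_)
      rintro _ ⟨g, rfl⟩
      exact ⟨V.toRepresentation g ⟨E, hEV⟩, U.apply_mem_toSubmodule g hU, rfl⟩
    obtain ⟨u, hu, huv⟩ := hle v.2
    rwa [← Subtype.ext huv]
  have key : ∀ (U : Subrepresentation V.toRepresentation) (u : V.toSubmodule), u ∈ U →
      P u ≠ 0 → U = ⊤ := by
    intro U u hu hPu
    obtain ⟨a, ha⟩ := Submodule.mem_span_singleton.1 (hPV u u.2)
    have ha0 : a ≠ 0 := by
      rintro rfl
      exact hPu (by rw [← ha, zero_smul])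
    have hmem : P u ∈ U.toSubmodule.map V.toSubmodule.subtype := by
      refine hP _ ?_ _ ⟨u, hu, rfl⟩
      rintro g _ ⟨w, hw, rfl⟩
      exact ⟨V.toRepresentation g w, U.apply_mem_toSubmodule g hw, rfl⟩
    obtain ⟨w, hw, hwu⟩ := hmem
    refine htop U ?_
    have : (⟨E, hEV⟩ : V.toSubmodule) = a⁻¹ • w := by
      apply Subtype.ext
      change E = a⁻¹ • (w : M)
      rw [show (w : M) = P u from hwu, ← ha, smul_smul, inv_mul_cancel₀ ha0, one_smul]
    rw [this]
    exact U.toSubmodule.smul_mem _ hw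
  have : Nontrivial (Subrepresentation V.toRepresentation) := by
    refine ⟨⊥, ⊤, fun h => hE ?_⟩
    have : (⟨E, hEV⟩ : V.toSubmodule) ∈ (⊥ : Subrepresentation V.toRepresentation) := by
      rw [h]
      exact Submodule.mem_top
    exact congrArg Subtype.val ((Submodule.mem_bot ℂ).1 this)
  refine ⟨fun U => ?_⟩
  obtain ⟨U', hU'⟩ := exists_isCompl U
  have hsup : (⟨E, hEV⟩ : V.toSubmodule) ∈ U.toSubmodule ⊔ U'.toSubmodule := by
    rw [← Subrepresentation.toSubmodule_sup, hU'.sup_eq_top]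
    exact Submodule.mem_top
  obtain ⟨u, hu, u', hu', huu⟩ := Submodule.mem_sup.1 hsup
  have hne : P u + P u' ≠ 0 := by
    have : (u : M) + u' = E := congrArg Subtype.val huu
    rw [← map_add, this, hc]
    exact smul_ne_zero hc0 hE
  by_cases h : P u = 0
  · left
    have : U' = ⊤ := key U' u' hu' fun h' => hne (by rw [h, h', add_zero])
    rw [this] at hU'
    exact eq_bot_of_isCompl_top hU'
  · exact Or.inr (key U u hu h)

/-- Schur's lemma for an equivariant operator `D` that does not vanish on the generator `F` of an
irreducible subrepresentation. -/
theorem exists_subrepresentation_map {G M : Type*} [Group G] [AddCommGroup M] [Module ℂ M]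
    (ρ : Representation ℂ G M) (D : Module.End ℂ M) (hD : ∀ g v, D (ρ g v) = ρ g (D v))
    {N : Submodule ℂ M} {F : M} (hN : N = Submodule.span ℂ (Set.range fun g => ρ g F))
    (hirr : F ≠ 0 → ∀ V : Subrepresentation ρ, V.toSubmodule = N →
      V.toRepresentation.IsIrreducible) (hDF : D F ≠ 0) :
    ∃ V W : Subrepresentation ρ, V.toSubmodule = N ∧ W.toSubmodule = N.map D ∧
      V.toRepresentation.IsIrreducible ∧
      Nonempty (Representation.Equiv W.toRepresentation V.toRepresentation) ∧
      W.toSubmodule = Submodule.span ℂ (Set.range fun g => ρ g (D F)) := by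
  have hF : F ≠ 0 := fun h => hDF (by rw [h, map_zero])
  let V : Subrepresentation ρ :=
    { toSubmodule := N
      apply_mem_toSubmodule := by
        intro g v hv
        rw [hN] at hv ⊢
        refine (Submodule.span_le
          (p := (Submodule.span ℂ (Set.range fun g => ρ g F)).comap (ρ g))).2 ?_ hv
        rintro _ ⟨g', rfl⟩
        refine Submodule.subset_span ⟨g * g', ?_⟩
        simp only [map_mul, Module.End.mul_apply] }
  let W : Subrepresentation ρ :=
    { toSubmodule := N.map D
      apply_mem_toSubmodule := by
        rintro g _ ⟨v, hv, rfl⟩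
        exact ⟨ρ g v, V.apply_mem_toSubmodule g hv, hD g v⟩ }
  have hVirr : V.toRepresentation.IsIrreducible := hirr hF V rfl
  refine ⟨V, W, rfl, rfl, hVirr, ?_, ?_⟩
  · let φ : Representation.IntertwiningMap V.toRepresentation W.toRepresentation :=
      (D.restrict fun v hv => Submodule.mem_map_of_mem hv :
        V.toSubmodule →ₗ[ℂ] W.toSubmodule).intertwiningMap_of_isIntertwiningMap _ _
        fun g v => Subtype.ext (hD g v)
    have hFV : F ∈ V.toSubmodule := by
      change F ∈ N
      rw [hN]
      exact Submodule.subset_span ⟨1, by simp⟩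
    have hinj : Function.Injective φ := by
      refine (Representation.IsIrreducible.injective_or_eq_zero φ).resolve_right fun h => hDF ?_
      have := congrArg (fun ψ => (ψ ⟨F, hFV⟩ : W.toSubmodule)) h
      exact congrArg Subtype.val this
    have hsurj : Function.Surjective φ := by
      rintro ⟨_, v, hv, rfl⟩
      exact ⟨⟨v, hv⟩, rfl⟩
    exact ⟨(φ.ofBijective ⟨hinj, hsurj⟩).symm⟩
  · change N.map D = _
    rw [hN, Submodule.map_span, ← Set.range_comp]
    simp only [Function.comp_def, hD]

/-! ### Garnir relations and straightening -/

section Straightening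

open Classical in
/-- The permutations that fix every point outside `X`. -/
def supportedPerms {α : Type} [Fintype α] (X : Finset α) : Finset (Equiv.Perm α) :=
  Finset.univ.filter fun π => ∀ c, c ∉ X → π c = c

theorem mem_supportedPerms {α : Type} [Fintype α] {X : Finset α} {π : Equiv.Perm α} :
    π ∈ supportedPerms X ↔ ∀ c, c ∉ X → π c = c := by
  simp [supportedPerms]

theorem apply_mem_of_mem_supportedPerms {α : Type} [Fintype α] {X : Finset α}
    {π : Equiv.Perm α} (hπ : π ∈ supportedPerms X) {c : α} (hc : c ∈ X) : π c ∈ X := by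
  by_contra h
  exact h (by rwa [π.injective (mem_supportedPerms.1 hπ _ h)])

variable {ι : Type} [Fintype ι] {shape : ι → YoungDiagram}
  {M : Type*} [AddCommGroup M] [Module ℂ M] (ρ : Representation ℂ (CellPerm shape) M)

/-- The Garnir relation: if every column-preserving permutation sends two cells of `X` to one row,
then the signed sum of the permutations of `X` kills `C⁻ R⁺ v`. -/
theorem garnir_relation [DecidableEq ι] (i : ι) (X : Finset (shape i).cells)
    (hX : ∀ τ : Equiv.Perm (shape i).cells, (∀ c, (τ c).1.2 = c.1.2) →
      ∃ x ∈ X, ∃ y ∈ X, x ≠ y ∧ (τ x).1.1 = (τ y).1.1) (v : M) :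
    ∑ π ∈ supportedPerms X,
      ((Equiv.Perm.sign π : ℤ) : ℂ) • ρ (Pi.mulSingle i π) (colAlt ρ (rowSum ρ v)) = 0 := by
  simp only [colAlt_apply, map_sum, Finset.smul_sum]
  rw [Finset.sum_comm]
  refine Finset.sum_eq_zero fun τ _ => ?_
  obtain ⟨x, hx, y, hy, hne, hrow⟩ := hX _ (((mem_colGroup shape).1 (inv_mem τ.2)) i)
  -- the transposition of `x` and `y` becomes a row permutation after conjugation by `τ`
  have hfix : ρ (Pi.mulSingle i (Equiv.swap x y)) (ρ τ (rowSum ρ v)) = ρ τ (rowSum ρ v) := by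
    have h := mul_mulSingle_swap shape τ.1 i ((τ.1 i)⁻¹ x) ((τ.1 i)⁻¹ y)
    simp only [Equiv.Perm.inv_def, Equiv.apply_symm_apply] at h
    rw [← Module.End.mul_apply (ρ _) (ρ _), ← map_mul, ← h, map_mul, Module.End.mul_apply,
      apply_rowSum ρ (mulSingle_mem_rowGroup shape (swap_row_preserving ?_))]
    simpa using hrow
  have hsum : ∑ π ∈ supportedPerms X, ((Equiv.Perm.sign π : ℤ) : ℂ) •
        ρ (Pi.mulSingle i π) (((cellSign shape τ : ℤ) : ℂ) • ρ τ (rowSum ρ v)) =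
      -∑ π ∈ supportedPerms X, ((Equiv.Perm.sign π : ℤ) : ℂ) •
        ρ (Pi.mulSingle i π) (((cellSign shape τ : ℤ) : ℂ) • ρ τ (rowSum ρ v)) := by
    rw [← Finset.sum_neg_distrib]
    refine Finset.sum_equiv (Equiv.mulRight (Equiv.swap x y)) (fun π => ?_) fun π _ => ?_
    · simp only [mem_supportedPerms, Equiv.coe_mulRight, Equiv.Perm.mul_apply]
      refine forall₂_congr fun c hc => ?_
      rw [Equiv.swap_apply_of_ne_of_ne (by rintro rfl; exact hc hx) (by rintro rfl; exact hc hy)]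
    · simp only [Equiv.coe_mulRight, Equiv.Perm.sign_swap hne,
        Pi.mulSingle_mul, map_mul, Module.End.mul_apply, map_smul, hfix]
      simp
  have := IsAddTorsionFree.of_isTorsionFree ℂ M
  exact self_eq_neg.1 hsum

/-- For cells `a`, `b` of a row, with `b` to the right of `a`, the cells weakly below `a` in its
column and weakly above `b` in its column are more than the column of `a` has rows.  Hence any
column permutation sends two of them to one row. -/
theorem garnir_collision {μ : YoungDiagram} {a b : μ.cells} (hrow : a.1.1 = b.1.1)
    (hcol : a.1.2 < b.1.2) (τ : Equiv.Perm μ.cells) (hτ : ∀ c, (τ c).1.2 = c.1.2) :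
    ∃ x ∈ (Finset.univ.filter fun c : μ.cells => c.1.2 = a.1.2 ∧ a.1.1 ≤ c.1.1) ∪
        Finset.univ.filter fun c : μ.cells => c.1.2 = b.1.2 ∧ c.1.1 ≤ b.1.1,
      ∃ y ∈ (Finset.univ.filter fun c : μ.cells => c.1.2 = a.1.2 ∧ a.1.1 ≤ c.1.1) ∪
        Finset.univ.filter fun c : μ.cells => c.1.2 = b.1.2 ∧ c.1.1 ≤ b.1.1,
      x ≠ y ∧ (τ x).1.1 = (τ y).1.1 := by
  set A := Finset.univ.filter fun c : μ.cells => c.1.2 = a.1.2 ∧ a.1.1 ≤ c.1.1 with hA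
  set B := Finset.univ.filter fun c : μ.cells => c.1.2 = b.1.2 ∧ c.1.1 ≤ b.1.1 with hB
  have ha : a.1.1 < μ.colLen a.1.2 := YoungDiagram.mem_iff_lt_colLen.1 a.2
  have hcardA : μ.colLen a.1.2 - a.1.1 ≤ A.card := by
    rw [← Nat.card_Ico]
    refine le_trans (Finset.card_le_card ?_) (Finset.card_image_le (f := fun c => c.1.1))
    intro k hk
    rw [Finset.mem_Ico] at hk
    exact Finset.mem_image.2 ⟨⟨(k, a.1.2), YoungDiagram.mem_iff_lt_colLen.2 hk.2⟩,
      by simp [hA, hk.1], rfl⟩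
  have hcardB : b.1.1 + 1 ≤ B.card := by
    rw [← Finset.card_range (b.1.1 + 1)]
    refine le_trans (Finset.card_le_card ?_) (Finset.card_image_le (f := fun c => c.1.1))
    intro k hk
    rw [Finset.mem_range, Nat.lt_succ_iff] at hk
    exact Finset.mem_image.2 ⟨⟨(k, b.1.2), μ.up_left_mem hk le_rfl b.2⟩, by simp [hB, hk], rfl⟩
  have hdisj : Disjoint A B := by
    rw [Finset.disjoint_left]
    intro c hc hc'
    simp only [hA, hB, Finset.mem_filter, Finset.mem_univ, true_and] at hc hc'
    omega
  have hcard : (Finset.range (μ.colLen a.1.2)).card < (A ∪ B).card := by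
    rw [Finset.card_union_of_disjoint hdisj, Finset.card_range]
    omega
  obtain ⟨x, hx, y, hy, hne, h⟩ := Finset.exists_ne_map_eq_of_card_lt_of_maps_to hcard
    (f := fun c => (τ c).1.1) (by
      intro c hc
      have hc' : (τ c).1.1 < μ.colLen (τ c).1.2 := YoungDiagram.mem_iff_lt_colLen.1 (τ c).2
      rw [hτ] at hc'
      simp only [hA, hB, Finset.coe_union, Finset.coe_filter, Finset.mem_univ, true_and,
        Set.mem_union, Set.mem_ofPred_eq] at hc
      simp only [Finset.coe_range, Set.mem_Iio]
      refine hc'.trans_le (μ.colLen_anti _ _ ?_)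
      omega)
  exact ⟨x, hx, y, hy, hne, h⟩

/-- The strict rearrangement inequality for a permutation supported on a set on which the two
functions are oppositely ordered. -/
theorem sum_mul_lt_sum_mul_perm {α : Type} [Fintype α] [DecidableEq α] (w f : α → ℕ)
    (X : Finset α) (π : Equiv.Perm α) (hπ : π ∈ supportedPerms X) (hwf : AntivaryOn w f X)
    (h : ¬ AntivaryOn w (f ∘ π) X) :
    ∑ c, w c * f c < ∑ c, w c * f (π c) := by
  rw [← Finset.sum_add_sum_compl X fun c => w c * f c,
    ← Finset.sum_add_sum_compl X fun c => w c * f (π c)]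
  refine add_lt_add_of_lt_of_le ((AntivaryOn.sum_mul_lt_sum_mul_comp_perm_iff hwf ?_).2 h) ?_
  · intro c hc
    by_contra hcX
    exact hc (mem_supportedPerms.1 hπ c hcX)
  · refine (Finset.sum_congr rfl fun c hc => ?_).le
    rw [mem_supportedPerms.1 hπ c (Finset.mem_compl.1 hc)]

/-- Let the entries `f` increase down the columns and let `a`, `b` be a descent in a row.  Then the
entries of the Garnir set in the column of `a` all exceed those in the column of `b`, so every
permutation of the Garnir set that does not preserve columns increases `∑ column · entry`. -/
theorem sum_col_mul_lt {μ : YoungDiagram} {f : μ.cells → ℕ}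
    (hcolf : ∀ c c' : μ.cells, c.1.2 = c'.1.2 → c.1.1 < c'.1.1 → f c < f c')
    {a b : μ.cells} (hcol : a.1.2 < b.1.2) (hab : f b < f a) {π : Equiv.Perm μ.cells}
    (hπ : π ∈ supportedPerms
      ((Finset.univ.filter fun c : μ.cells => c.1.2 = a.1.2 ∧ a.1.1 ≤ c.1.1) ∪
        Finset.univ.filter fun c : μ.cells => c.1.2 = b.1.2 ∧ c.1.1 ≤ b.1.1))
    (hπcol : ∃ c, (π c).1.2 ≠ c.1.2) :
    ∑ c : μ.cells, c.1.2 * f c < ∑ c : μ.cells, c.1.2 * f (π c) := by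
  set A := Finset.univ.filter fun c : μ.cells => c.1.2 = a.1.2 ∧ a.1.1 ≤ c.1.1 with hA
  set B := Finset.univ.filter fun c : μ.cells => c.1.2 = b.1.2 ∧ c.1.1 ≤ b.1.1 with hB
  have memA : ∀ c, c ∈ A ↔ c.1.2 = a.1.2 ∧ a.1.1 ≤ c.1.1 := by simp [hA]
  have memB : ∀ c, c ∈ B ↔ c.1.2 = b.1.2 ∧ c.1.1 ≤ b.1.1 := by simp [hB]
  have hfA : ∀ c ∈ A, f a ≤ f c := by
    intro c hc
    obtain ⟨h₁, h₂⟩ := (memA c).1 hc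
    rcases h₂.eq_or_lt with h | h
    · rw [show a = c from Subtype.ext (Prod.ext h h₁.symm)]
    · exact (hcolf a c h₁.symm h).le
  have hfB : ∀ c ∈ B, f c ≤ f b := by
    intro c hc
    obtain ⟨h₁, h₂⟩ := (memB c).1 hc
    rcases h₂.eq_or_lt with h | h
    · rw [show c = b from Subtype.ext (Prod.ext h h₁)]
    · exact (hcolf c b h₁ h).le
  have hAB : ∀ c ∈ A ∪ B, c ∈ A ∨ c ∈ B := fun c hc => Finset.mem_union.1 hc
  -- since `π` moves some cell to another column, it moves a cell of `B` into `A`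
  obtain ⟨y, hyB, hyA⟩ : ∃ y ∈ B, π y ∈ A := by
    by_contra! hno
    have hmaps : ∀ c ∈ B, π c ∈ B := fun c hc =>
      (hAB _ (apply_mem_of_mem_supportedPerms hπ (Finset.mem_union_right _ hc))).resolve_left
        (hno c hc)
    have himage : B.image π = B := Finset.eq_of_subset_of_card_le
      (Finset.image_subset_iff.2 hmaps) (Finset.card_image_of_injective B π.injective).ge
    obtain ⟨c, hc⟩ := hπcol
    by_cases hcX : c ∈ A ∪ B
    · rcases hAB c hcX with hcA | hcB
      · rcases hAB _ (apply_mem_of_mem_supportedPerms hπ hcX) with h | h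
        · exact hc (((memA _).1 h).1.trans ((memA _).1 hcA).1.symm)
        · rw [← himage, Finset.mem_image] at h
          obtain ⟨d, hd, hdc⟩ := h
          rw [π.injective hdc] at hd
          have h₁ := ((memA _).1 hcA).1
          have h₂ := ((memB _).1 hd).1
          omega
      · exact hc (((memB _).1 (hmaps c hcB)).1.trans ((memB _).1 hcB).1.symm)
    · exact hc (by rw [mem_supportedPerms.1 hπ c hcX])
  obtain ⟨x, hxA, hxB⟩ : ∃ x ∈ A, π x ∈ B := by
    by_contra! hno
    have hmaps : ∀ c ∈ A, π c ∈ A := fun c hc =>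
      (hAB _ (apply_mem_of_mem_supportedPerms hπ (Finset.mem_union_left _ hc))).resolve_right
        (hno c hc)
    have himage : A.image π = A := Finset.eq_of_subset_of_card_le
      (Finset.image_subset_iff.2 hmaps) (Finset.card_image_of_injective A π.injective).ge
    rw [← himage, Finset.mem_image] at hyA
    obtain ⟨d, hd, hdc⟩ := hyA
    rw [π.injective hdc] at hd
    have h₁ := ((memA _).1 hd).1
    have h₂ := ((memB _).1 hyB).1
    omega
  refine sum_mul_lt_sum_mul_perm (fun c : μ.cells => c.1.2) f (A ∪ B) π hπ ?_ ?_
  · intro c hc d hd hcd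
    rcases hAB c hc with hcA | hcB <;> rcases hAB d hd with hdA | hdB
    · exact (((memA d).1 hdA).1.trans ((memA c).1 hcA).1.symm).le
    · have := hfA c hcA
      have := hfB d hdB
      omega
    · change d.1.2 ≤ c.1.2
      have := ((memA d).1 hdA).1
      have := ((memB c).1 hcB).1
      omega
    · exact (((memB d).1 hdB).1.trans ((memB c).1 hcB).1.symm).le
  · intro h
    have h₁ : y.1.2 ≤ x.1.2 := by
      refine h (Finset.mem_union_left _ hxA) (Finset.mem_union_right _ hyB) ?_
      have := hfA _ hyA
      have := hfB _ hxB
      simp only [Function.comp]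
      omega
    have h₂ := ((memA x).1 hxA).1
    have h₃ := ((memB y).1 hyB).1
    omega

/-- Exchanging the entries of a descent in a column increases `∑ row · entry`. -/
theorem sum_row_mul_lt {μ : YoungDiagram} {f : μ.cells → ℕ} {a b : μ.cells}
    (hrow : a.1.1 < b.1.1) (hab : f b < f a) :
    ∑ c : μ.cells, c.1.1 * f c < ∑ c : μ.cells, c.1.1 * f (Equiv.swap a b c) := by
  refine sum_mul_lt_sum_mul_perm (fun c : μ.cells => c.1.1) f {a, b} (Equiv.swap a b) ?_ ?_ ?_
  · rw [mem_supportedPerms]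
    intro c hc
    simp only [Finset.mem_insert, Finset.mem_singleton, not_or] at hc
    exact Equiv.swap_apply_of_ne_of_ne hc.1 hc.2
  · intro c hc d hd hcd
    simp only [Finset.coe_insert, Finset.coe_singleton, Set.mem_insert_iff,
      Set.mem_singleton_iff] at hc hd
    rcases hc with rfl | rfl <;> rcases hd with rfl | rfl <;> first | omega | exact hrow.le
  · intro h
    have h₁ : b.1.1 ≤ a.1.1 := h (by simp) (by simp) (by simpa using hab)
    omega

/-- The sum of `z(cell) · entry` for the filling `t ∘ p`.  It is used with `z` the row and the
column coordinate. -/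
def weight (z : ℕ × ℕ → ℕ) (t : ∀ i, (shape i).cells → ℕ) (p : CellPerm shape) : ℕ :=
  ∑ i, ∑ c, z c.1 * t i (p i c)

theorem weight_lt [DecidableEq ι] {z : ℕ × ℕ → ℕ} {t : ∀ i, (shape i).cells → ℕ}
    {p : CellPerm shape} {i : ι}
    {π : Equiv.Perm (shape i).cells}
    (h : ∑ c : (shape i).cells, z c.1 * t i (p i c) <
      ∑ c : (shape i).cells, z c.1 * t i (p i (π c))) :
    weight z t p < weight z t (p * Pi.mulSingle i π) := by
  refine Finset.sum_lt_sum (fun j _ => ?_) ⟨i, Finset.mem_univ i, by simpa using h⟩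
  rcases eq_or_ne j i with rfl | hj
  · simpa using h.le
  · simp [Pi.mulSingle_eq_of_ne hj]

theorem weight_mul_mem_colGroup (t : ∀ i, (shape i).cells → ℕ) (p : CellPerm shape)
    {q : CellPerm shape} (hq : q ∈ colGroup shape) :
    weight Prod.snd t (p * q) = weight Prod.snd t p := by
  refine Finset.sum_congr rfl fun i _ => ?_
  refine Fintype.sum_equiv (q i) _ _ fun c => ?_
  rw [(mem_colGroup shape).1 hq i c]
  rfl

/-- Straightening: the vectors `ρ q (C⁻ R⁺ v)` for which the filling `t ∘ q` is standard span all
the vectors `ρ p (C⁻ R⁺ v)`. -/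
theorem mem_span_standard [DecidableEq ι] (t : ∀ i, (shape i).cells → ℕ)
    (ht : ∀ i, Function.Injective (t i))
    (v : M) (p : CellPerm shape) :
    ρ p (colAlt ρ (rowSum ρ v)) ∈ Submodule.span ℂ
      {u | ∃ q : CellPerm shape, (∀ i, StrictFilling fun c => t i (q i c)) ∧
        u = ρ q (colAlt ρ (rowSum ρ v))} := by
  classical
  set E := colAlt ρ (rowSum ρ v) with hE
  set N := Submodule.span ℂ
      {u | ∃ q : CellPerm shape, (∀ i, StrictFilling fun c => t i (q i c)) ∧ u = ρ q E} with hN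
  by_contra hp
  have : Fintype (CellPerm shape) := Pi.instFintype
  obtain ⟨p, hpbad, hpmax⟩ := Finset.exists_max_image
    (Finset.univ.filter fun p : CellPerm shape => ρ p E ∉ N)
    (fun p => toLex (weight Prod.snd t p, weight Prod.fst t p)) ⟨p, by simpa using hp⟩
  simp only [Finset.mem_filter, Finset.mem_univ, true_and] at hpbad hpmax
  -- column permutations change the vector only by a sign
  have hcolE : ∀ q ∈ colGroup shape, ρ (p * q) E = ((cellSign shape q : ℤ) : ℂ) • ρ p E := by
    intro q hq
    rw [map_mul, Module.End.mul_apply, hE, apply_colAlt ρ hq, map_smul]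
  have hcol : ∀ i (c c' : (shape i).cells), c.1.2 = c'.1.2 → c.1.1 < c'.1.1 →
      t i (p i c) < t i (p i c') := by
    intro i c c' hcc hlt
    by_contra hnot
    have hgt : t i (p i c') < t i (p i c) := by
      refine lt_of_le_of_ne (not_lt.1 hnot) fun h => ?_
      rw [(p i).injective (ht i h)] at hlt
      exact lt_irrefl _ hlt
    have hq : Pi.mulSingle i (Equiv.swap c c') ∈ colGroup shape :=
      mulSingle_mem_colGroup shape (swap_col_preserving hcc)
    refine absurd (hpmax (p * Pi.mulSingle i (Equiv.swap c c')) fun h => hpbad ?_) (not_le.2 ?_)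
    · rw [hcolE _ hq] at h
      have h' := N.smul_mem ((cellSign shape (Pi.mulSingle i (Equiv.swap c c')) : ℤ) : ℂ) h
      rwa [smul_smul, sign_mul_sign_complex, one_smul] at h'
    · rw [Prod.Lex.toLex_lt_toLex]
      exact Or.inr ⟨(weight_mul_mem_colGroup t p hq).symm,
        weight_lt (sum_row_mul_lt (f := fun c => t i (p i c)) hlt hgt)⟩
  refine hpbad (Submodule.subset_span ⟨p, fun i => ⟨fun a b hrow hab => ?_, hcol i⟩, rfl⟩)
  by_contra hnot
  have hgt : t i (p i b) < t i (p i a) := by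
    refine lt_of_le_of_ne (not_lt.1 hnot) fun h => ?_
    rw [(p i).injective (ht i h)] at hab
    exact lt_irrefl _ hab
  have hG := garnir_relation ρ i _ (garnir_collision hrow hab) v
  rw [← hE] at hG
  set Q := supportedPerms
      ((Finset.univ.filter fun c : (shape i).cells => c.1.2 = a.1.2 ∧ a.1.1 ≤ c.1.1) ∪
        Finset.univ.filter fun c : (shape i).cells => c.1.2 = b.1.2 ∧ c.1.1 ≤ b.1.1) with hQ
  have hG' := congrArg (ρ p) hG
  simp only [map_sum, map_smul, map_zero, ← Module.End.mul_apply (ρ p), ← map_mul ρ p] at hG'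
  rw [← Finset.sum_filter_add_sum_filter_not Q fun π => ∀ c, (π c).1.2 = c.1.2] at hG'
  -- the column-preserving terms of the Garnir relation all equal `ρ p E`
  have h₁ : ∑ π ∈ Q.filter fun π => ∀ c, (π c).1.2 = c.1.2,
      ((Equiv.Perm.sign π : ℤ) : ℂ) • ρ (p * Pi.mulSingle i π) E =
      ((Q.filter fun π => ∀ c, (π c).1.2 = c.1.2).card : ℂ) • ρ p E := by
    rw [Nat.cast_smul_eq_nsmul, ← Finset.sum_const]
    refine Finset.sum_congr rfl fun π hπ => ?_
    rw [hcolE _ (mulSingle_mem_colGroup shape (Finset.mem_filter.1 hπ).2), cellSign_mulSingle,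
      smul_smul, sign_mul_sign_complex, one_smul]
  -- the other terms belong to fillings of larger weight
  have h₂ : ∑ π ∈ Q.filter fun π => ¬ ∀ c, (π c).1.2 = c.1.2,
      ((Equiv.Perm.sign π : ℤ) : ℂ) • ρ (p * Pi.mulSingle i π) E ∈ N := by
    refine Submodule.sum_mem _ fun π hπ => N.smul_mem _ ?_
    rw [Finset.mem_filter, not_forall] at hπ
    by_contra hbad
    refine absurd (hpmax _ hbad) (not_le.2 ?_)
    rw [Prod.Lex.toLex_lt_toLex]
    exact Or.inl (weight_lt (sum_col_mul_lt (f := fun c => t i (p i c))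
      (hcol i) hab hgt hπ.1 hπ.2))
  rw [h₁] at hG'
  have h₃ := (Submodule.add_mem_iff_left N h₂).1 (hG' ▸ N.zero_mem)
  refine hpbad ((N.smul_mem_iff (Nat.cast_ne_zero.2 (Finset.card_pos.2 ⟨1, ?_⟩).ne')).1 h₃)
  simp [hQ, mem_supportedPerms]

end Straightening

/-! ### Equivariance of the differential operators -/

section Operators

variable {r : ℕ} {ν : Fin r → ℕ}

theorem repU_algebraMap (g : SymProd ν) (f : OX ν) :
    repU ν g (algebraMap (OX ν) (OU ν) f) = algebraMap (OX ν) (OU ν) (rename (embed ν g) f) :=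
  actU_algebraMap ν g f

theorem repU_mul (g : SymProd ν) (u v : OU ν) : repU ν g (u * v) = repU ν g u * repU ν g v :=
  map_mul (actU ν g) u v

/-- On every block `Δ` is a Vandermonde determinant, hence it is invariant up to sign. -/
theorem rename_disc_sq (g : SymProd ν) : rename (embed ν g) (disc ν) ^ 2 = disc ν ^ 2 := by
  have hblock : ∀ (i : Fin r) (v : Fin (ν i) → OX ν),
      ∏ a : Fin (ν i), ∏ b ∈ Finset.Ioi a, (v a - v b) =
        (Matrix.vandermonde fun a => -v a).det := by
    intro i v
    rw [Matrix.det_vandermonde]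
    exact Finset.prod_congr rfl fun a _ => Finset.prod_congr rfl fun b _ => by ring
  simp only [disc, map_prod, map_sub, rename_X, embed_apply, ← Finset.prod_pow]
  refine Finset.prod_congr rfl fun i _ => ?_
  simp only [Finset.prod_pow]
  rw [hblock i fun a => X (finSigmaFinEquiv ⟨i, g i a⟩),
    hblock i fun a => X (finSigmaFinEquiv ⟨i, a⟩)]
  have : (Matrix.vandermonde fun a => -(X (finSigmaFinEquiv ⟨i, g i a⟩) : OX ν)) =
      (Matrix.vandermonde fun a => -(X (finSigmaFinEquiv ⟨i, a⟩) : OX ν)).submatrix (g i) id := by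
    ext a b
    simp [Matrix.vandermonde]
  rw [this, Matrix.det_permute, mul_pow]
  rcases Int.units_eq_one_or (Equiv.Perm.sign (g i)) with h | h <;> simp [h]

theorem repU_invSelf_sq (g : SymProd ν) :
    repU ν g (IsLocalization.Away.invSelf (S := OU ν) (disc ν) ^ 2) =
      IsLocalization.Away.invSelf (S := OU ν) (disc ν) ^ 2 := by
  have h₁ : algebraMap (OX ν) (OU ν) (disc ν ^ 2) *
      IsLocalization.Away.invSelf (S := OU ν) (disc ν) ^ 2 = 1 := by
    rw [map_pow, ← mul_pow, IsLocalization.Away.mul_invSelf, one_pow]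
  have h₂ := congrArg (repU ν g) h₁
  rw [repU_mul, repU_algebraMap, map_pow, rename_disc_sq,
    show repU ν g 1 = 1 from map_one (actU ν g)] at h₂
  have hu : IsUnit (algebraMap (OX ν) (OU ν) (disc ν ^ 2)) := IsUnit.of_mul_eq_one _ h₁
  exact hu.mul_left_cancel (h₂.trans h₁.symm)

theorem derivation_eval {A : Type*} [CommRing A] [Algebra ℂ A] (δ : Derivation ℂ A A)
    (P : Polynomial A) (hP : ∀ k, δ (P.coeff k) = 0) (u : A) :
    δ (P.eval u) = P.derivative.eval u * δ u := by
  rw [Polynomial.eval_eq_sum_range, map_sum, Polynomial.derivative_eval,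
    Polynomial.sum_over_range _ (by simp), Finset.sum_mul]
  refine Finset.sum_congr rfl fun k _ => ?_
  rw [Derivation.leibniz, hP, Derivation.leibniz_pow]
  simp [mul_assoc]

/-- The monic polynomial `∏ (t - x_b)` whose roots are the variables of the `i`-th block. -/
def blockPoly (ν : Fin r → ℕ) (i : Fin r) : Polynomial (OX ν) :=
  ∏ b : Fin (ν i), (Polynomial.X - Polynomial.C (X (finSigmaFinEquiv ⟨i, b⟩)))

theorem coeff_blockPoly_mem_OY (i : Fin r) (k : ℕ) : (blockPoly ν i).coeff k ∈ OY ν := by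
  intro g
  have h : (blockPoly ν i).map (rename (embed ν g) : OX ν →ₐ[ℂ] OX ν).toRingHom =
      blockPoly ν i := by
    rw [blockPoly, Polynomial.map_prod]
    refine Fintype.prod_equiv (g i) _ _ fun b => ?_
    simp [embed_apply]
  conv_rhs => rw [← h]
  rw [Polynomial.coeff_map]
  rfl

/-- A derivation of `𝒪_U` that kills the invariant polynomials is zero: `0 = δ(P(x)) = P'(x) δ(x)`
for each variable `x` and the polynomial `P` of its block, and `P'(x)` is a unit. -/
theorem derivation_eq_zero (δ : Derivation ℂ (OU ν) (OU ν))
    (hδ : ∀ f ∈ OY ν, δ (algebraMap (OX ν) (OU ν) f) = 0) : δ = 0 := by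
  have hX : ∀ j, δ (algebraMap (OX ν) (OU ν) (X j)) = 0 := by
    intro j
    obtain ⟨⟨i, a⟩, rfl⟩ := finSigmaFinEquiv.surjective j
    set x := algebraMap (OX ν) (OU ν) (X (finSigmaFinEquiv ⟨i, a⟩)) with hx
    have hfac : (blockPoly ν i).map (algebraMap (OX ν) (OU ν)) =
        (Polynomial.X - Polynomial.C x) * ∏ b ∈ Finset.univ.erase a,
          (Polynomial.X -
            Polynomial.C (algebraMap (OX ν) (OU ν) (X (finSigmaFinEquiv ⟨i, b⟩)))) := by
      rw [blockPoly, Polynomial.map_prod, ← Finset.mul_prod_erase _ _ (Finset.mem_univ a)]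
      simp [hx]
    have h := derivation_eval δ ((blockPoly ν i).map (algebraMap (OX ν) (OU ν)))
      (fun k => by rw [Polynomial.coeff_map]; exact hδ _ (coeff_blockPoly_mem_OY i k)) x
    rw [hfac] at h
    simp only [Polynomial.eval_mul, Polynomial.eval_sub, Polynomial.eval_X, Polynomial.eval_C,
      sub_self, zero_mul, map_zero, Polynomial.derivative_mul, Polynomial.derivative_X_sub_C,
      one_mul, Polynomial.eval_add, add_zero, Polynomial.eval_prod] at h
    refine ((IsUnit.mul_right_eq_zero ?_).1 h.symm)
    refine IsUnit.prod_iff.2 fun b hb => ?_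
    rw [hx, ← map_sub]
    exact isUnit_sub ν i a b (Finset.ne_of_mem_erase hb).symm
  have hpoly : ∀ f, δ (algebraMap (OX ν) (OU ν) f) = 0 := by
    intro f
    induction f using MvPolynomial.induction_on with
    | C c =>
      rw [← MvPolynomial.algebraMap_eq, ← IsScalarTower.algebraMap_apply]
      exact δ.map_algebraMap c
    | add p q hp hq => rw [map_add, map_add, hp, hq, add_zero]
    | mul_X p j hp => rw [map_mul, Derivation.leibniz, hp, hX, smul_zero, smul_zero, add_zero]
  ext u
  obtain ⟨⟨f, s⟩, hfs⟩ := IsLocalization.surj (Submonoid.powers (disc ν)) u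
  have h := congrArg δ hfs
  simp only [Derivation.leibniz, hpoly, smul_eq_mul, mul_zero, zero_add] at h
  exact (IsUnit.mul_right_eq_zero (IsLocalization.map_units (OU ν) s)).1 h

/-- There is at most one derivation `∂/∂y_j`. -/
theorem IsPartialY.eq {y : Fin (∑ i, ν i) → OX ν}
    (hyY : Algebra.adjoin ℂ (Set.range y) = OY ν) {j : Fin (∑ i, ν i)}
    {d d' : Derivation ℂ (OU ν) (OU ν)} (hd : IsPartialY ν y j d) (hd' : IsPartialY ν y j d') :
    d = d' := by
  refine sub_eq_zero.1 (derivation_eq_zero _ fun f hf => ?_)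
  rw [← hyY] at hf
  induction hf using Algebra.adjoin_induction with
  | mem f hf =>
    obtain ⟨k, rfl⟩ := hf
    simp [hd k, hd' k]
  | algebraMap c =>
    rw [← IsScalarTower.algebraMap_apply]
    exact Derivation.map_algebraMap _ c
  | add p q _ _ hp hq => rw [map_add, map_add, hp, hq, add_zero]
  | mul p q _ _ hp hq => rw [map_mul, Derivation.leibniz, hp, hq, smul_zero, smul_zero, add_zero]

theorem repU_inv_apply (g : SymProd ν) (u : OU ν) : repU ν g (repU ν g⁻¹ u) = u := by
  rw [← Module.End.mul_apply, ← map_mul, mul_inv_cancel, map_one, Module.End.one_apply]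

theorem repU_apply_inv (g : SymProd ν) (u : OU ν) : repU ν g⁻¹ (repU ν g u) = u := by
  rw [← Module.End.mul_apply, ← map_mul, inv_mul_cancel, map_one, Module.End.one_apply]

/-- `∂/∂y_j` is equivariant, since its conjugates under the group are again `∂/∂y_j`. -/
theorem IsPartialY.apply_repU {y : Fin (∑ i, ν i) → OX ν}
    (hyY : Algebra.adjoin ℂ (Set.range y) = OY ν) {j : Fin (∑ i, ν i)}
    {d : Derivation ℂ (OU ν) (OU ν)} (hd : IsPartialY ν y j d) (g : SymProd ν) (u : OU ν) :
    d (repU ν g u) = repU ν g (d u) := by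
  let d' : Derivation ℂ (OU ν) (OU ν) :=
    Derivation.mk' (repU ν g ∘ₗ d.toLinearMap ∘ₗ repU ν g⁻¹) fun a b => by
      simp only [LinearMap.comp_apply, repU_mul, Derivation.coeFn_coe, Derivation.leibniz,
        smul_eq_mul, map_add, repU_inv_apply]
  have hd' : IsPartialY ν y j d' := by
    intro k
    have hk : y k ∈ OY ν := hyY ▸ Algebra.subset_adjoin ⟨k, rfl⟩
    change repU ν g (d (repU ν g⁻¹ _)) = _
    rw [repU_algebraMap, hk g⁻¹, hd k]
    split_ifs
    · exact map_one (actU ν g)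
    · exact map_zero _
  rw [hd.eq hyY hd']
  change repU ν g (d (repU ν g⁻¹ (repU ν g u))) = repU ν g (d' u)
  rw [repU_apply_inv, ← hd.eq hyY hd']

theorem DV_apply_repU {y : Fin (∑ i, ν i) → OX ν}
    (hyY : Algebra.adjoin ℂ (Set.range y) = OY ν) {D : Module.End ℂ (OU ν)} (hD : D ∈ DV ν y)
    (g : SymProd ν) (u : OU ν) : D (repU ν g u) = repU ν g (D u) := by
  induction hD using Algebra.adjoin_induction generalizing u with
  | mem P hP =>
    rcases hP with (⟨j, rfl⟩ | ⟨j, d, hd, rfl⟩) | rfl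
    · have hj : y j ∈ OY ν := hyY ▸ Algebra.subset_adjoin ⟨j, rfl⟩
      simp only [LinearMap.mulLeft_apply, repU_mul]
      rw [repU_algebraMap, hj g]
    · exact hd.apply_repU hyY g u
    · simp only [LinearMap.mulLeft_apply, repU_mul]
      rw [repU_invSelf_sq]
  | algebraMap c => simp [Module.algebraMap_end_apply]
  | add P Q _ _ hP hQ => simp [hP, hQ]
  | mul P Q _ _ hP hQ => simp [hP, hQ]

end Operators

/-! ### Higher Specht polynomials as polytabloids -/

section Bridge

variable {r : ℕ} {ν : Fin r → ℕ} {lam : RDiagram ν}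

/-- The identification of `𝔖_{n₁} × ⋯ × 𝔖_{n_r}` with the permutations of the boxes of `λ` given by
the filling `t`. -/
def cellConj (t : ∀ i, (lam.shape i).cells ≃ Fin (ν i)) : CellPerm lam.shape ≃* SymProd ν :=
  MulEquiv.piCongrRight fun i => (t i).permCongrHom

theorem cellConj_apply (t : ∀ i, (lam.shape i).cells ≃ Fin (ν i)) (p : CellPerm lam.shape)
    (i : Fin r) (c : (lam.shape i).cells) : cellConj t p i (t i c) = t i (p i c) := by
  simp [cellConj, Equiv.permCongrHom, Equiv.permCongr_apply]

/-- `T` is natural and its component `T^i` carries, at the cell `c`, the number `t i c` of the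
`i`-th block. -/
def HasLocalEntries (T : ST lam) (t : ∀ i, (lam.shape i).cells ≃ Fin (ν i)) : Prop :=
  ∀ i c, T.entry ⟨i, c⟩ = finSigmaFinEquiv ⟨i, t i c⟩

theorem ST.IsNatural.exists_hasLocalEntries {T : ST lam} (hT : T.IsNatural) :
    ∃ t, HasLocalEntries T t := by
  have h : ∀ i (c : (lam.shape i).cells), ∃ a : Fin (ν i),
      T.entry ⟨i, c⟩ = finSigmaFinEquiv ⟨i, a⟩ := by
    intro i c
    obtain ⟨⟨j, a⟩, hja⟩ := finSigmaFinEquiv.surjective (T.entry ⟨i, c⟩)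
    have hj := hT ⟨i, c⟩
    rw [← hja, block, Equiv.symm_apply_apply] at hj
    obtain rfl : j = i := hj
    exact ⟨a, hja.symm⟩
  choose t ht using h
  have hinj : ∀ i, Function.Injective (t i) := by
    intro i c c' hcc
    have : T.entry ⟨i, c⟩ = T.entry ⟨i, c'⟩ := by rw [ht, ht, hcc]
    simpa using T.entry.injective this
  have hbij : ∀ i, Function.Bijective (t i) := fun i =>
    (Fintype.bijective_iff_injective_and_card _).2 ⟨hinj i, by
      rw [Fintype.card_coe, Fintype.card_fin]
      exact lam.card_shape i⟩
  exact ⟨fun i => Equiv.ofBijective (t i) (hbij i), ht⟩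

theorem finSigmaFinEquiv_lt_iff (i : Fin r) (a b : Fin (ν i)) :
    finSigmaFinEquiv ⟨i, a⟩ < (finSigmaFinEquiv ⟨i, b⟩ : Fin (∑ i, ν i)) ↔ a < b := by
  rw [Fin.lt_def, finSigmaFinEquiv_apply, finSigmaFinEquiv_apply, add_lt_add_iff_left, Fin.lt_def]

theorem HasLocalEntries.isNatural {T : ST lam} {t : ∀ i, (lam.shape i).cells ≃ Fin (ν i)}
    (h : HasLocalEntries T t) : T.IsNatural := by
  rintro ⟨i, c⟩
  rw [h, block, Equiv.symm_apply_apply]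

theorem exists_hasLocalEntries_of_strictFilling (t : ∀ i, (lam.shape i).cells ≃ Fin (ν i))
    (ht : ∀ i, StrictFilling (t i)) : ∃ T : ST lam, HasLocalEntries T t := by
  refine ⟨⟨(Equiv.sigmaCongrRight t).trans finSigmaFinEquiv, fun i => ⟨?_, ?_⟩⟩, fun i c => rfl⟩
  · intro c c' h₁ h₂
    exact (finSigmaFinEquiv_lt_iff i _ _).2 ((ht i).1 c c' h₁ h₂)
  · intro c c' h₁ h₂
    exact (finSigmaFinEquiv_lt_iff i _ _).2 ((ht i).2 c c' h₁ h₂)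

/-- The permutation of the numbers `1, …, n` that moves the entries of `t` as given on the boxes. -/
def entryPerm (t : ∀ i, (lam.shape i).cells ≃ Fin (ν i)) :
    CellPerm lam.shape →* Equiv.Perm (Fin (∑ i, ν i)) :=
  (embed ν).comp (cellConj t).toMonoidHom

variable {T : ST lam} {t : ∀ i, (lam.shape i).cells ≃ Fin (ν i)}

theorem HasLocalEntries.entryPerm_apply (h : HasLocalEntries T t) (p : CellPerm lam.shape)
    (i : Fin r) (c : (lam.shape i).cells) :
    entryPerm t p (T.entry ⟨i, c⟩) = T.entry ⟨i, p i c⟩ := by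
  rw [h, h, ← cellConj_apply, ← embed_apply]
  rfl

theorem HasLocalEntries.sign_entryPerm_mulSingle (h : HasLocalEntries T t) (i : Fin r)
    (π : Equiv.Perm (lam.shape i).cells) :
    Equiv.Perm.sign (entryPerm t (Pi.mulSingle i π)) = Equiv.Perm.sign π := by
  induction π using Equiv.Perm.swap_induction_on with
  | one => simp
  | swap_mul π x y hxy hπ =>
    have hswap : entryPerm t (Pi.mulSingle i (Equiv.swap x y)) =
        Equiv.swap (T.entry ⟨i, x⟩) (T.entry ⟨i, y⟩) := by
      refine Equiv.ext fun k => ?_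
      obtain ⟨⟨j, c⟩, rfl⟩ := T.entry.surjective k
      rw [h.entryPerm_apply, T.entry.injective.swap_apply]
      congr 1
      rcases eq_or_ne j i with rfl | hj
      · rw [Pi.mulSingle_eq_same]
        exact (Function.Injective.swap_apply
          (sigma_mk_injective (β := fun i => (lam.shape i).cells) (i := j)) x y c).symm
      · rw [Pi.mulSingle_eq_of_ne hj, Equiv.swap_apply_of_ne_of_ne] <;> simp [hj]
    have hne : T.entry ⟨i, x⟩ ≠ T.entry ⟨i, y⟩ := fun hxy' => hxy (by
      simpa using T.entry.injective hxy')
    rw [Pi.mulSingle_mul, map_mul, Equiv.Perm.sign_mul, hswap, Equiv.Perm.sign_swap hne, hπ,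
      Equiv.Perm.sign_mul, Equiv.Perm.sign_swap hxy]

theorem HasLocalEntries.entryPerm_mulSingle_injective (h : HasLocalEntries T t) (i : Fin r) :
    Function.Injective fun π : Equiv.Perm (lam.shape i).cells =>
      entryPerm t (Pi.mulSingle i π) := by
  intro π π' hππ
  refine Equiv.ext fun c => ?_
  have := congrArg (fun σ => σ (T.entry ⟨i, c⟩)) hππ
  simp only [h.entryPerm_apply, Pi.mulSingle_eq_same] at this
  simpa using T.entry.injective this

/-- A description of the row and the column stabilizer of `T^i` (for `z` the row and the column
coordinate) through permutations of the cells. -/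
theorem HasLocalEntries.preserving_iff (h : HasLocalEntries T t) (i : Fin r) (z : ℕ × ℕ → ℕ)
    (σ : Equiv.Perm (Fin (∑ i, ν i))) :
    ((∀ b : lam.Box, b.1 ≠ i → σ (T.entry b) = T.entry b) ∧
      ∀ c : (lam.shape i).cells, ∃ c' : (lam.shape i).cells,
        σ (T.entry ⟨i, c⟩) = T.entry ⟨i, c'⟩ ∧ z c'.1 = z c.1) ↔
    ∃ π : Equiv.Perm (lam.shape i).cells, (∀ c, z (π c).1 = z c.1) ∧
      entryPerm t (Pi.mulSingle i π) = σ := by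
  constructor
  · rintro ⟨hfix, hσ⟩
    choose f hf hz using hσ
    have hinj : Function.Injective f := by
      intro c c' hcc
      have : σ (T.entry ⟨i, c⟩) = σ (T.entry ⟨i, c'⟩) := by rw [hf, hf, hcc]
      simpa using T.entry.injective (σ.injective this)
    refine ⟨Equiv.ofBijective f (Finite.injective_iff_bijective.1 hinj), hz, ?_⟩
    refine Equiv.ext fun k => ?_
    obtain ⟨⟨j, c⟩, rfl⟩ := T.entry.surjective k
    rw [h.entryPerm_apply]
    rcases eq_or_ne j i with rfl | hj
    · rw [Pi.mulSingle_eq_same, hf]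
      rfl
    · rw [Pi.mulSingle_eq_of_ne hj, hfix _ hj]
      rfl
  · rintro ⟨π, hπ, rfl⟩
    refine ⟨?_, fun c => ⟨π c, by rw [h.entryPerm_apply, Pi.mulSingle_eq_same], hπ c⟩⟩
    rintro ⟨j, c⟩ hj
    rw [h.entryPerm_apply, Pi.mulSingle_eq_of_ne hj]
    rfl

open Classical in
/-- The permutations of the cells that preserve every row. -/
def rowPerms (μ : YoungDiagram) : Finset (Equiv.Perm μ.cells) :=
  Finset.univ.filter fun π => ∀ c, (π c).1.1 = c.1.1

open Classical in
/-- The permutations of the cells that preserve every column. -/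
def colPerms (μ : YoungDiagram) : Finset (Equiv.Perm μ.cells) :=
  Finset.univ.filter fun π => ∀ c, (π c).1.2 = c.1.2

theorem mem_rowPerms {μ : YoungDiagram} {π : Equiv.Perm μ.cells} :
    π ∈ rowPerms μ ↔ ∀ c, (π c).1.1 = c.1.1 := by
  simp [rowPerms]

theorem mem_colPerms {μ : YoungDiagram} {π : Equiv.Perm μ.cells} :
    π ∈ colPerms μ ↔ ∀ c, (π c).1.2 = c.1.2 := by
  simp [colPerms]

theorem HasLocalEntries.youngSymm_eq (h : HasLocalEntries T t) (i : Fin r) :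
    T.youngSymm i = ((numStd (lam.shape i) : ℂ) / ((ν i).factorial : ℂ)) •
      ∑ x ∈ rowPerms (lam.shape i) ×ˢ colPerms (lam.shape i),
        MonoidAlgebra.single (entryPerm t (Pi.mulSingle i (x.2 * x.1)))
          ((Equiv.Perm.sign x.2 : ℤ) : ℂ) := by
  classical
  have hrow : Finset.univ.filter (· ∈ T.rowStab i) =
      (rowPerms (lam.shape i)).image fun π => entryPerm t (Pi.mulSingle i π) := by
    ext σ
    simp only [Finset.mem_filter, Finset.mem_univ, true_and, Finset.mem_image, mem_rowPerms]
    exact h.preserving_iff i Prod.fst σ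
  have hcol : Finset.univ.filter (· ∈ T.colStab i) =
      (colPerms (lam.shape i)).image fun π => entryPerm t (Pi.mulSingle i π) := by
    ext σ
    simp only [Finset.mem_filter, Finset.mem_univ, true_and, Finset.mem_image, mem_colPerms]
    exact h.preserving_iff i Prod.snd σ
  rw [ST.youngSymm, Finset.sum_product]
  congr 1
  convert_to ∑ σ ∈ Finset.univ.filter (· ∈ T.rowStab i),
    ∑ τ ∈ Finset.univ.filter (· ∈ T.colStab i),
      MonoidAlgebra.single (τ * σ) ((Equiv.Perm.sign τ : ℤ) : ℂ) = _
  rw [hrow, hcol, Finset.sum_image (h.entryPerm_mulSingle_injective i).injOn]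
  refine Finset.sum_congr rfl fun π _ => ?_
  rw [Finset.sum_image (h.entryPerm_mulSingle_injective i).injOn]
  refine Finset.sum_congr rfl fun π' _ => ?_
  rw [h.sign_entryPerm_mulSingle, Pi.mulSingle_mul, map_mul]

theorem prod_ofFn_single {H : Type*} [Monoid H] {n : ℕ} (a : Fin n → H) (b : Fin n → ℂ) :
    (List.ofFn fun i => MonoidAlgebra.single (a i) (b i)).prod =
      MonoidAlgebra.single (List.ofFn a).prod (∏ i, b i) := by
  induction n with
  | zero => simp [MonoidAlgebra.one_def]
  | succ n ih =>
    rw [List.ofFn_succ, List.prod_cons, ih, MonoidAlgebra.single_mul_single, List.ofFn_succ,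
      List.prod_cons, Fin.prod_univ_succ]

theorem prod_ofFn_mulSingle {n : ℕ} {H : Fin n → Type*} [∀ i, Monoid (H i)] (q : ∀ i, H i) :
    (List.ofFn fun i => Pi.mulSingle i (q i)).prod = q := by
  funext j
  rw [Pi.list_prod_apply, List.ofFn_eq_map, List.map_map, List.prod_map_eq_pow_single j]
  · simp [List.count_eq_one_of_mem (List.nodup_finRange n) (List.mem_finRange j)]
  · intro k hk _
    simp [Pi.mulSingle_eq_of_ne hk.symm]

/-- The product of the normalizing factors `f^{λ^i} / n_i!`. -/
def normalization (lam : RDiagram ν) : ℂ :=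
  ∏ i, (numStd (lam.shape i) : ℂ) / ((ν i).factorial : ℂ)

/-- The product `e_{T^1} ⋯ e_{T^r}`, multiplied out by multilinearity: it is a multiple of the
signed sum over the products of the column and the row stabilizers. -/
theorem HasLocalEntries.symmetrizer_eq (h : HasLocalEntries T t) :
    T.symmetrizer = normalization lam •
      ∑ x ∈ Fintype.piFinset fun i => rowPerms (lam.shape i) ×ˢ colPerms (lam.shape i),
        MonoidAlgebra.single (entryPerm t fun i => (x i).2 * (x i).1)
          (∏ i, ((Equiv.Perm.sign (x i).2 : ℤ) : ℂ)) := by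
  simp only [ST.symmetrizer, h.youngSymm_eq]
  rw [← MultilinearMap.mkPiAlgebraFin_apply (R := ℂ), MultilinearMap.map_smul_univ,
    MultilinearMap.map_sum_finset]
  congr 1
  refine Finset.sum_congr rfl fun x _ => ?_
  rw [MultilinearMap.mkPiAlgebraFin_apply, prod_ofFn_single]
  congr 1
  conv_rhs => rw [← prod_ofFn_mulSingle fun i => (x i).2 * (x i).1]
  rw [map_list_prod, List.map_ofFn]
  rfl

/-- `𝒪_U` as a representation of the permutations of the boxes of `λ`, the boxes being identified
with the numbers `1, …, n` through the tableau `t`. -/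
def cellRep (t : ∀ i, (lam.shape i).cells ≃ Fin (ν i)) :
    Representation ℂ (CellPerm lam.shape) (OU ν) :=
  (repU ν).comp (cellConj t).toMonoidHom

theorem cellRep_apply (p : CellPerm lam.shape) : cellRep t p = repU ν (cellConj t p) := rfl

theorem cellRep_algebraMap (p : CellPerm lam.shape) (f : OX ν) :
    cellRep t p (algebraMap (OX ν) (OU ν) f) =
      algebraMap (OX ν) (OU ν) (rename (entryPerm t p) f) :=
  repU_algebraMap _ f

theorem HasLocalEntries.higherSpechtU_eq (h : HasLocalEntries T t) (S : ST lam) :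
    higherSpechtU T S = normalization lam •
      colAlt (cellRep t) (rowSum (cellRep t) (algebraMap (OX ν) (OU ν) (mono T S))) := by
  rw [higherSpechtU, higherSpecht, h.symmetrizer_eq, map_smul, LinearMap.smul_apply,
    ← IsScalarTower.toAlgHom_apply ℂ (OX ν) (OU ν), map_smul]
  congr 1
  rw [map_sum, LinearMap.sum_apply, map_sum, rowSum_apply, map_sum]
  simp only [colAlt_apply]
  rw [Finset.sum_comm, ← Finset.sum_product', Finset.univ_product_univ]
  symm
  refine Finset.sum_bij (fun y _ i => (y.2.1 i, y.1.1 i)) ?_ ?_ ?_ ?_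
  · intro y _
    simp only [Fintype.mem_piFinset, Finset.mem_product, mem_rowPerms, mem_colPerms]
    exact fun i => ⟨y.2.2 i, y.1.2 i⟩
  · intro y _ y' _ hyy
    refine Prod.ext (Subtype.ext (funext fun i => ?_)) (Subtype.ext (funext fun i => ?_))
    · exact congrArg Prod.snd (congrFun hyy i)
    · exact congrArg Prod.fst (congrFun hyy i)
  · intro x hx
    simp only [Fintype.mem_piFinset, Finset.mem_product, mem_rowPerms, mem_colPerms] at hx
    exact ⟨(⟨fun i => (x i).2, fun i => (hx i).2⟩, ⟨fun i => (x i).1, fun i => (hx i).1⟩),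
      Finset.mem_univ _, rfl⟩
  · intro y _
    rw [Representation.asAlgebraHom_single, LinearMap.smul_apply, map_smul,
      IsScalarTower.toAlgHom_apply, ← Module.End.mul_apply, ← map_mul, cellRep_algebraMap,
      cellSign_apply]
    push_cast
    rfl

theorem HasLocalEntries.mono_eq {T' : ST lam} {t' : ∀ i, (lam.shape i).cells ≃ Fin (ν i)}
    (h : HasLocalEntries T t) (h' : HasLocalEntries T' t') {p : CellPerm lam.shape}
    (hp : ∀ i c, t' i c = t i (p i c)) (S : ST lam) :
    mono T' S = rename (entryPerm t p) (mono T S) := by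
  simp only [mono, map_prod, map_pow, rename_X]
  refine Finset.prod_congr rfl fun b _ => ?_
  rw [h.entryPerm_apply, h, h', hp]

/-- The actions of box permutations through the fillings `t` and `t ∘ p` are intertwined by `p`. -/
theorem cellRep_comp {t' : ∀ i, (lam.shape i).cells ≃ Fin (ν i)} {p : CellPerm lam.shape}
    (hp : ∀ i c, t' i c = t i (p i c)) (q : CellPerm lam.shape) (u : OU ν) :
    cellRep t' q (cellRep t p u) = cellRep t p (cellRep t q u) := by
  have : cellConj t' q * cellConj t p = cellConj t p * cellConj t q := by
    funext i
    refine Equiv.ext fun a => ?_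
    obtain ⟨c, rfl⟩ := (t i).surjective a
    simp only [Pi.mul_apply, Equiv.Perm.mul_apply, cellConj_apply]
    rw [← hp, cellConj_apply, hp]
  simp only [cellRep_apply]
  rw [← Module.End.mul_apply, ← map_mul, this, map_mul, Module.End.mul_apply]

theorem HasLocalEntries.higherSpechtU_comp {T' : ST lam}
    {t' : ∀ i, (lam.shape i).cells ≃ Fin (ν i)} (h : HasLocalEntries T t)
    (h' : HasLocalEntries T' t') {p : CellPerm lam.shape}
    (hp : ∀ i c, t' i c = t i (p i c)) (S : ST lam) :
    higherSpechtU T' S = cellRep t p (higherSpechtU T S) := by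
  rw [h.higherSpechtU_eq, h'.higherSpechtU_eq, h.mono_eq h' hp, ← cellRep_algebraMap, map_smul]
  congr 1
  simp only [rowSum_apply, colAlt_apply, map_sum, map_smul, cellRep_comp hp]

/-- `V^S(λ)` is the `ℂ[G]`-module generated by `F_T^S`. -/
theorem HasLocalEntries.spechtSpan_eq (h : HasLocalEntries T t) (S : ST lam) :
    spechtSpan S = Submodule.span ℂ (Set.range fun g => repU ν g (higherSpechtU T S)) := by
  apply le_antisymm
  · refine Submodule.span_mono ?_
    rintro _ ⟨T', hT', rfl⟩
    obtain ⟨t', h'⟩ := hT'.exists_hasLocalEntries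
    let p : CellPerm lam.shape := fun i => (t' i).trans (t i).symm
    exact ⟨cellConj t p, (h.higherSpechtU_comp h' (p := p) (by simp [p]) S).symm⟩
  · rw [Submodule.span_le]
    rintro _ ⟨g, rfl⟩
    obtain ⟨p, rfl⟩ := (cellConj t).surjective g
    change cellRep t p (higherSpechtU T S) ∈ spechtSpan S
    have hspan := mem_span_standard (cellRep t) (fun i c => (t i c : ℕ))
      (fun i => Fin.val_injective.comp (t i).injective) (algebraMap (OX ν) (OU ν) (mono T S)) p
    rw [h.higherSpechtU_eq, map_smul]
    refine Submodule.span_induction (p := fun u _ => normalization lam • u ∈ spechtSpan S)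
      ?_ ?_ ?_ ?_ hspan
    · rintro _ ⟨q, hq, rfl⟩
      obtain ⟨T', h'⟩ := exists_hasLocalEntries_of_strictFilling
        (fun i => (q i).trans (t i)) hq
      refine Submodule.subset_span ⟨T', h'.isNatural, ?_⟩
      rw [h.higherSpechtU_comp h' (p := q) (by simp), h.higherSpechtU_eq, map_smul]
    · simp
    · intro u v _ _ hu hv
      rw [smul_add]
      exact Submodule.add_mem _ hu hv
    · intro a u _ hu
      rw [smul_comm]
      exact Submodule.smul_mem _ a hu

theorem HasLocalEntries.isIrreducible (h : HasLocalEntries T t) (S : ST lam)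
    (hF : higherSpechtU T S ≠ 0) (V : Subrepresentation (repU ν))
    (hV : V.toSubmodule = spechtSpan S) : V.toRepresentation.IsIrreducible := by
  have hsp := h.spechtSpan_eq S
  set F := higherSpechtU T S with hFdef
  refine isIrreducible_of_rank_one (repU ν) V (colAlt (cellRep t)) F
    (Fintype.card (colGroup lam.shape)) (hV.trans hsp) ?_ ?_ ?_ ?_ hF
  · intro U hU u hu
    rw [colAlt_apply]
    exact Submodule.sum_mem _ fun τ _ => U.smul_mem _ (hU _ u hu)
  · intro g
    obtain ⟨p, rfl⟩ := (cellConj t).surjective g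
    obtain ⟨a, ha⟩ := exists_colAlt_apply_colAlt_rowSum (cellRep t) p
      (algebraMap (OX ν) (OU ν) (mono T S))
    refine Submodule.mem_span_singleton.2 ⟨a, ?_⟩
    rw [← cellRep_apply, hFdef, h.higherSpechtU_eq, map_smul, map_smul, ha, smul_comm]
  · rw [hFdef, h.higherSpechtU_eq, map_smul, colAlt_colAlt, smul_comm]
  · exact Nat.cast_ne_zero.2 Fintype.card_ne_zero

end Bridge

end HigherSpecht

end

theorem theorem3p18 {r : ℕ} (ν : Fin r → ℕ)
    (y : Fin (∑ i, ν i) → HigherSpecht.OX ν)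
    (hy : AlgebraicIndependent ℂ y)
    (hyY : Algebra.adjoin ℂ (Set.range y) = HigherSpecht.OY ν)
    (lam : HigherSpecht.RDiagram ν) (S T : HigherSpecht.ST lam) (hT : T.IsNatural)
    (D : Module.End ℂ (HigherSpecht.OU ν)) (hD : D ∈ HigherSpecht.DV ν y)
    (hDF : D (HigherSpecht.higherSpechtU T S) ≠ 0) :
    ∃ V W : Subrepresentation (HigherSpecht.repU ν),
      V.toSubmodule = HigherSpecht.spechtSpan S ∧
      W.toSubmodule = (HigherSpecht.spechtSpan S).map D ∧
      V.toRepresentation.IsIrreducible ∧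
      Nonempty (Representation.Equiv W.toRepresentation V.toRepresentation) ∧
      W.toSubmodule = Submodule.span ℂ
        (Set.range fun g => HigherSpecht.repU ν g (D (HigherSpecht.higherSpechtU T S))) := by
  obtain ⟨t, ht⟩ := hT.exists_hasLocalEntries
  exact HigherSpecht.exists_subrepresentation_map (HigherSpecht.repU ν) D
    (HigherSpecht.DV_apply_repU hyY hD) (ht.spechtSpan_eq S)
    (fun hF V hV => ht.isIrreducible S hF V hV) hDF
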